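/- Let $A=a_1\dots a_m$ and $B=b_1\dots b_n$ be strings over an arbitrary alphabet, with prefixes $A_i=a_1\dots a_i$ and $B_j=b_1\dots b_j$. The rank $L[i,j]$ of a position $[i,j]$ ($0\le i\le m$, $0\le j\le n$) is $0$ if $i=0$ or $j=0$, is $L[i-1,j-1]+1$ if $[i,j]$ is a match (i.e. $i,j>0$ and $a_i=b_j$), and is $\max\{L[i-1,j],L[i,j-1]\}$ otherwise. In the all-prefixes-LCSs-graph (for distinct LCSs) every vertex $[i,j]$ has an edge to each match $[i^*,j^*]$ with $i^*\le i$, $j^*\le j$, $L[i^*,j^*]=L[i,j]$ that is antidominant for $A_i,B_j$, i.e. such that there is no other match $[i',j']$ with $L[i',j']=L[i,j]$ and either $i'=i^*$, $j\ge j'>j^*$ or $j'=j^*$, $i\ge i'>i^*$. The adjacency list of $[i,j]$ is the list of these matches ordered from lower left to upper right (decreasing row, increasing column). The graph is stored as follows. Each position has one link field $\mathrm{next}$, shared by all adjacency lists, and for each $[i,j]$ there are pointers $\mathrm{head}[i,j]$, $\mathrm{pretail}[i,j]$, $\mathrm{tail}[i,j]$: $\mathrm{tail}[i,j]$ is the last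 node of the adjacency list of $[i,j]$ (null if the list is empty), and the other nodes form an ordinary linked list along the $\mathrm{next}$ fields from $\mathrm{head}[i,j]$ to $\mathrm{pretail}[i,j]$ ($\mathrm{head}[i,j]$ is null if there are no other nodes). On a machine with unit-cost elementary operations (register and array access, pointer following, successor, predecessor, comparison, equality test of two symbols, printing a symbol), there are a constant $C$ and two fixed programs, all independent of the strings and of the alphabet, such that the following holds for all $A$, $B$. 1. The first program is a row-by-row dynamic program: it runs through the positions $[i,j]$, $0\le i\le m$, $0\le j\le n$, row by row, executing at each one the same loop-free code, which compares only the symbols $a_i$ and $b_j$, reads the arrays $L$, head, pretail, tail only at $[i,j]$, $[i-1,j]$, $[i,j-1]$, $[i-1,j-1]$, writes them only at $[i,j]$, and may follow and set link fields. From any initial memory contents it halts after at most $C(m+1)(n+1)$ operations (so in $O(mn)$ time for $m,n\ge1$) with all ranks and the all-prefixes-LCSs-graph of $A$ and $B$ stored as above. 2. From any memory contents in which the ranks and the graph are so stored, and for any given $0\le i\le m$, $0\le j\le n$, the second program prints all distinct longest common subsequences of $A_i$ and $B_j$, each exactly once and followed by an end-of-string marker, halts after at most $C$ times the length of this output, and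 leaves the graph stored for further queries. -/

import Mathlib

/-! ### Longest common subsequences, ranks, and the all-prefixes-LCSs-graph -/

namespace LCS

universe u

/-- `w` is a longest common subsequence of `x` and `y` (as a string of symbols). -/
def IsLCS {α : Type u} (w x y : List α) : Prop :=
  w.Sublist x ∧ w.Sublist y ∧ ∀ v : List α, v.Sublist x → v.Sublist y → v.length ≤ w.length

/-- The `k`-th symbol of a string, counted from `1`. -/
def symAt {α : Type u} (w : List α) : ℕ → Option α
  | 0 => none
  | k + 1 => w[k]?

/-- `[i, j]` is a match: `1 ≤ i ≤ m`, `1 ≤ j ≤ n` and `a_i = b_j`. -/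
def IsMatch {α : Type u} (A B : List α) (i j : ℕ) : Prop :=
  ∃ c, symAt A i = some c ∧ symAt B j = some c

open Classical in
/-- The rank `L[i, j]`, by the usual recurrence. -/
noncomputable def rank {α : Type u} (A B : List α) : ℕ → ℕ → ℕ
  | 0, _ => 0
  | _ + 1, 0 => 0
  | i + 1, j + 1 =>
    if IsMatch A B (i + 1) (j + 1) then rank A B i j + 1
    else max (rank A B i (j + 1)) (rank A B (i + 1) j)
  termination_by i j => (i, j)

/-- A position `[i, j]`; also the value of a non-null pointer. -/
abbrev Node : Type := ℕ × ℕ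

/-- `v` is a match lying in the submatrix of the prefixes `A_i`, `B_j` and has the rank of
`[i, j]`. -/
def IsCandidate {α : Type u} (A B : List α) (i j : ℕ) (v : Node) : Prop :=
  v.1 ≤ i ∧ v.2 ≤ j ∧ IsMatch A B v.1 v.2 ∧ rank A B v.1 v.2 = rank A B i j

/-- The all-prefixes-LCSs-graph (for distinct LCSs): the vertex `[i, j]` has an edge to `v` iff
`v` is a match of the rank of `[i, j]` that is antidominant with respect to `A_i` and `B_j`. -/
def Edge {α : Type u} (A B : List α) (i j : ℕ) (v : Node) : Prop :=
  IsCandidate A B i j v ∧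
    ¬ ∃ w : Node, IsCandidate A B i j w ∧ (w.1 = v.1 ∧ v.2 < w.2 ∨ w.2 = v.2 ∧ v.1 < w.1)

/-- `l` is the adjacency list of `[i, j]`: it consists of the targets of the edges from `[i, j]`,
each once, ordered along the contour from lower left to upper right. -/
def IsAdjacencyList {α : Type u} (A B : List α) (i j : ℕ) (l : List Node) : Prop :=
  (∀ v, v ∈ l ↔ Edge A B i j v) ∧ l.Pairwise (fun v w => w.1 < v.1 ∧ v.2 < w.2)

/-! ### A machine with unit-cost elementary operations

The input strings are read-only and their symbols can only be tested for equality and printed.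
A word of memory holds a number or a pointer. The arithmetic on numbers is successor and
predecessor, so that numbers stay polynomial in the running time. -/

/-- A pointer: the null pointer `none`, or a position. -/
abbrev Ptr : Type := Option Node

/-- The memory. `num` and `ptr` are registers (a program mentions finitely many of them);
`rank`, `head`, `pretail`, `tail` are arrays indexed by positions; every node of a linked list is
a position `v`, with one link field `next v`; `work` is a scratch array of pointers; `out` is a
write-only output tape, on which `none` is an end-of-string marker. -/
structure State (α : Type u) where
  num : ℕ → ℕ
  ptr : ℕ → Ptr
  rank : ℕ → ℕ → ℕ
  head : ℕ → ℕ → Ptr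
  pretail : ℕ → ℕ → Ptr
  tail : ℕ → ℕ → Ptr
  next : Node → Ptr
  work : ℕ → Ptr
  out : List (Option α)

inductive Ty : Type
  | num
  | ptr

/-- The values of the two types of expressions. -/
abbrev Ty.Val : Ty → Type
  | .num => ℕ
  | .ptr => Ptr

/-- Expressions; `lenA` and `lenB` are the lengths of the two input strings. -/
inductive Exp : Ty → Type
  | lit (k : ℕ) : Exp .num
  | reg (x : ℕ) : Exp .num
  | lenA : Exp .num
  | lenB : Exp .num
  | succ (e : Exp .num) : Exp .num
  | pred (e : Exp .num) : Exp .num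
  | rank (e f : Exp .num) : Exp .num
  | row (p : Exp .ptr) : Exp .num
  | col (p : Exp .ptr) : Exp .num
  | null : Exp .ptr
  | preg (x : ℕ) : Exp .ptr
  | mk (e f : Exp .num) : Exp .ptr
  | head (e f : Exp .num) : Exp .ptr
  | pretail (e f : Exp .num) : Exp .ptr
  | tail (e f : Exp .num) : Exp .ptr
  | next (p : Exp .ptr) : Exp .ptr
  | work (e : Exp .num) : Exp .ptr

/-- The value of an expression (following the null pointer gives `0` and null). -/
def Exp.eval {α : Type u} (A B : List α) (s : State α) : {τ : Ty} → Exp τ → τ.Val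
  | _, .lit k => k
  | _, .reg x => s.num x
  | _, .lenA => A.length
  | _, .lenB => B.length
  | _, .succ e => e.eval A B s + 1
  | _, .pred e => e.eval A B s - 1
  | _, .rank e f => s.rank (e.eval A B s) (f.eval A B s)
  | _, .row p => ((p.eval A B s).map Prod.fst).getD 0
  | _, .col p => ((p.eval A B s).map Prod.snd).getD 0
  | _, .null => none
  | _, .preg x => s.ptr x
  | _, .mk e f => some (e.eval A B s, f.eval A B s)
  | _, .head e f => s.head (e.eval A B s) (f.eval A B s)
  | _, .pretail e f => s.pretail (e.eval A B s) (f.eval A B s)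
  | _, .tail e f => s.tail (e.eval A B s) (f.eval A B s)
  | _, .next p => (p.eval A B s).bind s.next
  | _, .work e => s.work (e.eval A B s)

/-- The number of elementary operations in the evaluation of an expression. -/
def Exp.cost : {τ : Ty} → Exp τ → ℕ
  | _, .lit _ => 1
  | _, .reg _ => 1
  | _, .lenA => 1
  | _, .lenB => 1
  | _, .succ e => e.cost + 1
  | _, .pred e => e.cost + 1
  | _, .rank e f => e.cost + f.cost + 1
  | _, .row p => p.cost + 1
  | _, .col p => p.cost + 1
  | _, .null => 1
  | _, .preg _ => 1
  | _, .mk e f => e.cost + f.cost + 1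
  | _, .head e f => e.cost + f.cost + 1
  | _, .pretail e f => e.cost + f.cost + 1
  | _, .tail e f => e.cost + f.cost + 1
  | _, .next p => p.cost + 1
  | _, .work e => e.cost + 1

/-- Conditions; `isMatch e f` tests whether `a_e = b_f`. -/
inductive Cond : Type
  | lt (e f : Exp .num)
  | eq (e f : Exp .num)
  | ptrEq (p q : Exp .ptr)
  | isMatch (e f : Exp .num)
  | not (b : Cond)
  | and (b c : Cond)

def Cond.Holds {α : Type u} (A B : List α) (s : State α) : Cond → Prop
  | .lt e f => e.eval A B s < f.eval A B s
  | .eq e f => e.eval A B s = f.eval A B s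
  | .ptrEq p q => p.eval A B s = q.eval A B s
  | .isMatch e f => IsMatch A B (e.eval A B s) (f.eval A B s)
  | .not b => ¬ b.Holds A B s
  | .and b c => b.Holds A B s ∧ c.Holds A B s

def Cond.cost : Cond → ℕ
  | .lt e f => e.cost + f.cost + 1
  | .eq e f => e.cost + f.cost + 1
  | .ptrEq p q => p.cost + q.cost + 1
  | .isMatch e f => e.cost + f.cost + 1
  | .not b => b.cost + 1
  | .and b c => b.cost + c.cost + 1

/-- Programs. -/
inductive Cmd : Type
  | skip
  | setNum (x : ℕ) (e : Exp .num)
  | setPtr (x : ℕ) (p : Exp .ptr)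
  | setRank (e f g : Exp .num)
  | setHead (e f : Exp .num) (p : Exp .ptr)
  | setPretail (e f : Exp .num) (p : Exp .ptr)
  | setTail (e f : Exp .num) (p : Exp .ptr)
  | setNext (p q : Exp .ptr)
  | setWork (e : Exp .num) (p : Exp .ptr)
  | print (e : Exp .num)
  | endString
  | seq (c d : Cmd)
  | ite (b : Cond) (c d : Cmd)
  | while (b : Cond) (c : Cmd)

/-- A two-dimensional array after one write. -/
def write {β : Type} (f : ℕ → ℕ → β) (i j : ℕ) (x : β) : ℕ → ℕ → β :=
  Function.update f i (Function.update (f i) j x)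

/-- `Exec A B c s s' t`: on the input strings `A`, `B` and started in the memory state `s`, the
program `c` halts in the state `s'` after exactly `t` elementary operations. A program that writes
through the null pointer, or prints a symbol of `A` beyond its end, is stuck. -/
inductive Exec {α : Type u} (A B : List α) : Cmd → State α → State α → ℕ → Prop
  | skip (s : State α) : Exec A B .skip s s 1
  | setNum (s : State α) (x : ℕ) (e : Exp .num) :
      Exec A B (.setNum x e) s { s with num := Function.update s.num x (e.eval A B s) }
        (e.cost + 1)
  | setPtr (s : State α) (x : ℕ) (p : Exp .ptr) :
      Exec A B (.setPtr x p) s { s with ptr := Function.update s.ptr x (p.eval A B s) }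
        (p.cost + 1)
  | setRank (s : State α) (e f g : Exp .num) :
      Exec A B (.setRank e f g) s
        { s with rank := write s.rank (e.eval A B s) (f.eval A B s) (g.eval A B s) }
        (e.cost + f.cost + g.cost + 1)
  | setHead (s : State α) (e f : Exp .num) (p : Exp .ptr) :
      Exec A B (.setHead e f p) s
        { s with head := write s.head (e.eval A B s) (f.eval A B s) (p.eval A B s) }
        (e.cost + f.cost + p.cost + 1)
  | setPretail (s : State α) (e f : Exp .num) (p : Exp .ptr) :
      Exec A B (.setPretail e f p) s
        { s with pretail := write s.pretail (e.eval A B s) (f.eval A B s) (p.eval A B s) }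
        (e.cost + f.cost + p.cost + 1)
  | setTail (s : State α) (e f : Exp .num) (p : Exp .ptr) :
      Exec A B (.setTail e f p) s
        { s with tail := write s.tail (e.eval A B s) (f.eval A B s) (p.eval A B s) }
        (e.cost + f.cost + p.cost + 1)
  | setNext (s : State α) (p q : Exp .ptr) (v : Node) (hv : p.eval A B s = some v) :
      Exec A B (.setNext p q) s { s with next := Function.update s.next v (q.eval A B s) }
        (p.cost + q.cost + 1)
  | setWork (s : State α) (e : Exp .num) (p : Exp .ptr) :
      Exec A B (.setWork e p) s
        { s with work := Function.update s.work (e.eval A B s) (p.eval A B s) }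
        (e.cost + p.cost + 1)
  | print (s : State α) (e : Exp .num) (c : α) (hc : symAt A (e.eval A B s) = some c) :
      Exec A B (.print e) s { s with out := s.out ++ [some c] } (e.cost + 1)
  | endString (s : State α) :
      Exec A B .endString s { s with out := s.out ++ [none] } 1
  | seq (c d : Cmd) (s s' s'' : State α) (t t' : ℕ)
      (hc : Exec A B c s s' t) (hd : Exec A B d s' s'' t') :
      Exec A B (.seq c d) s s'' (t + t')
  | ite_pos (b : Cond) (c d : Cmd) (s s' : State α) (t : ℕ)
      (hb : b.Holds A B s) (hc : Exec A B c s s' t) :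
      Exec A B (.ite b c d) s s' (b.cost + t + 1)
  | ite_neg (b : Cond) (c d : Cmd) (s s' : State α) (t : ℕ)
      (hb : ¬ b.Holds A B s) (hd : Exec A B d s s' t) :
      Exec A B (.ite b c d) s s' (b.cost + t + 1)
  | while_done (b : Cond) (c : Cmd) (s : State α) (hb : ¬ b.Holds A B s) :
      Exec A B (.while b c) s s (b.cost + 1)
  | while_step (b : Cond) (c : Cmd) (s s' s'' : State α) (t t' : ℕ)
      (hb : b.Holds A B s) (hc : Exec A B c s s' t) (hw : Exec A B (.while b c) s' s'' t') :
      Exec A B (.while b c) s s'' (b.cost + t + t' + 1)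

/-! ### Row-by-row dynamic programs -/

/-- The row index `i` and the column index `j` of the current position. -/
abbrev iReg : Exp .num := .reg 0

abbrev jReg : Exp .num := .reg 1

/-- `for i = 0, …, m do for j = 0, …, n do cell`. -/
def rowByRow (cell : Cmd) : Cmd :=
  .seq (.setNum 0 (.lit 0))
    (.while (.not (.lt .lenA iReg))
      (.seq (.setNum 1 (.lit 0))
        (.seq
          (.while (.not (.lt .lenB jReg))
            (.seq cell (.setNum 1 (.succ jReg))))
          (.setNum 0 (.succ iReg)))))

/-- The pair of index expressions denotes one of the positions `[i, j]`, `[i-1, j]`, `[i, j-1]`,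
`[i-1, j-1]`. -/
def IsNeighbour (e f : Exp .num) : Prop :=
  (e = iReg ∨ e = .pred iReg) ∧ (f = jReg ∨ f = .pred jReg)

/-- The expression reads the arrays `rank`, `head`, `pretail`, `tail` only at `[i, j]` and its three
preceding neighbours, and does not use the scratch array. -/
def Exp.IsLocal : {τ : Ty} → Exp τ → Prop
  | _, .lit _ => True
  | _, .reg _ => True
  | _, .lenA => True
  | _, .lenB => True
  | _, .succ e => e.IsLocal
  | _, .pred e => e.IsLocal
  | _, .rank e f => IsNeighbour e f
  | _, .row p => p.IsLocal
  | _, .col p => p.IsLocal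
  | _, .null => True
  | _, .preg _ => True
  | _, .mk e f => e.IsLocal ∧ f.IsLocal
  | _, .head e f => IsNeighbour e f
  | _, .pretail e f => IsNeighbour e f
  | _, .tail e f => IsNeighbour e f
  | _, .next p => p.IsLocal
  | _, .work _ => False

/-- As for expressions; moreover the only pair of symbols that may be compared is `a_i`, `b_j`. -/
def Cond.IsLocal : Cond → Prop
  | .lt e f => e.IsLocal ∧ f.IsLocal
  | .eq e f => e.IsLocal ∧ f.IsLocal
  | .ptrEq p q => p.IsLocal ∧ q.IsLocal
  | .isMatch e f => e = iReg ∧ f = jReg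
  | .not b => b.IsLocal
  | .and b c => b.IsLocal ∧ c.IsLocal

/-- `c` is admissible as the body of a row-by-row dynamic program: it has no loop, does not print,
leaves the counters `i` and `j` alone, reads the arrays only at `[i, j]`, `[i-1, j]`, `[i, j-1]`,
`[i-1, j-1]`, writes them only at `[i, j]`, and otherwise only uses registers and sets link fields
of nodes. -/
def Cmd.IsCellStep : Cmd → Prop
  | .skip => True
  | .setNum x e => 2 ≤ x ∧ e.IsLocal
  | .setPtr _ p => p.IsLocal
  | .setRank e f g => e = iReg ∧ f = jReg ∧ g.IsLocal
  | .setHead e f p => e = iReg ∧ f = jReg ∧ p.IsLocal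
  | .setPretail e f p => e = iReg ∧ f = jReg ∧ p.IsLocal
  | .setTail e f p => e = iReg ∧ f = jReg ∧ p.IsLocal
  | .setNext p q => p.IsLocal ∧ q.IsLocal
  | .setWork _ _ => False
  | .print _ => False
  | .endString => False
  | .seq c d => c.IsCellStep ∧ d.IsCellStep
  | .ite b c d => b.IsLocal ∧ c.IsCellStep ∧ d.IsCellStep
  | .while _ _ => False

/-! ### The stored graph and the output -/

/-- The memory holds the list `l` at position `[i, j]`: `tail[i, j]` points to the last node (null
if the list is empty); the other nodes form an ordinary linked list from `head[i, j]` to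
`pretail[i, j]` along the link fields, `head[i, j]` being null if there are none. The last step,
from `pretail[i, j]` to `tail[i, j]`, need not be a link. -/
def State.HoldsList {α : Type u} (s : State α) (i j : ℕ) (l : List Node) : Prop :=
  (l = [] ∧ s.tail i j = none ∧ s.head i j = none) ∨
  ∃ (us : List Node) (v : Node), l = us ++ [v] ∧ s.tail i j = some v ∧
    s.head i j = us.head? ∧ (us ≠ [] → s.pretail i j = us.getLast?) ∧
    us.IsChain (fun x y => s.next x = some y)

/-- The memory holds the ranks and the all-prefixes-LCSs-graph of `A` and `B`; the link fields
`next` are shared by the adjacency lists of all vertices. -/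
def State.HoldsGraph {α : Type u} (s : State α) (A B : List α) : Prop :=
  ∀ i j : ℕ, i ≤ A.length → j ≤ B.length →
    s.rank i j = LCS.rank A B i j ∧ ∃ l, IsAdjacencyList A B i j l ∧ s.HoldsList i j l

/-- A list of strings as it appears on the output tape: each string is followed by an
end-of-string marker. -/
def tape {α : Type u} (ws : List (List α)) : List (Option α) :=
  ws.flatMap (fun w => w.map some ++ [none])

end LCS

namespace LCS

universe u

variable {α : Type u} {A B : List α}

/-! ### Ranks -/

/-! A match has larger rank than every position strictly above and to the left of it. Hence two
matches of equal rank are never strictly ordered in both coordinates (`IsCandidate.row_le`): the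
matches of one rank lie along a contour from lower left to upper right, and the antidominant ones
for $[i,j]$ are the extreme points of this contour after it is cut off at row $i$ and column $j$.

The lists obey a local recurrence. A match is its own only target. At any other position the
candidates come from the neighbour of larger rank, and in a tie from both neighbours. In a tie, the
only possible new node relative to the left list is the lowest candidate $y$ in column $j$, which is
the last node of the upper list; it is appended to the left list, or replaces its last node if that
node lies in the row of $y$ (`edge_of_eq_of_last_col`). So each cell copies pointers and sets at
most one link.

One link field per position suffices by `IsLink.unique`: if $q$ follows $p$ in a list and is not
last there, then $q$ depends on $p$ alone. A link set later therefore agrees with every list stored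
earlier (`IsStored.update`). The step to the last node has no such uniqueness argument, which is why
tails are stored apart.

A longest common subsequence of positive length ends at the last occurrences of its final symbol in
$A_i$ and $B_j$. These two indices form an antidominant match, and every antidominant match arises
from its symbol in this way. Paths in the graph thus correspond bijectively to the strings sought
(`mem_words`, `nodup_words`).

The second program is a backtracking search along these paths. No vertex on the way is a dead end,
so each move can be charged to a string printed below it. This gives constant cost per string and
level, plus the cost of printing, which is linear in the output (`traverses`). -/

theorem not_isMatch_zero_left (j : ℕ) : ¬ IsMatch A B 0 j := by
  rintro ⟨c, h, -⟩
  simp [symAt] at h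

theorem not_isMatch_zero_right (i : ℕ) : ¬ IsMatch A B i 0 := by
  rintro ⟨c, -, h⟩
  simp [symAt] at h

@[simp]
theorem rank_zero_left (j : ℕ) : rank A B 0 j = 0 := by
  unfold rank; rfl

@[simp]
theorem rank_zero_right (i : ℕ) : rank A B i 0 = 0 := by
  cases i <;> unfold rank <;> rfl

theorem rank_of_isMatch {i j : ℕ} (h : IsMatch A B (i + 1) (j + 1)) :
    rank A B (i + 1) (j + 1) = rank A B i j + 1 := by
  rw [rank, if_pos h]

theorem rank_of_not_isMatch {i j : ℕ} (h : ¬ IsMatch A B (i + 1) (j + 1)) :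
    rank A B (i + 1) (j + 1) = max (rank A B i (j + 1)) (rank A B (i + 1) j) := by
  rw [rank, if_neg h]

/-- Monotonicity and the unit bound have to be proved together: at a match the value $L[i-1,j-1]+1$
dominates both other neighbours only because these exceed $L[i-1,j-1]$ by at most one. -/
theorem rank_steps (N : ℕ) : ∀ i j : ℕ, i + j ≤ N →
    (rank A B i j ≤ rank A B (i + 1) j ∧ rank A B (i + 1) j ≤ rank A B i j + 1) ∧
    (rank A B i j ≤ rank A B i (j + 1) ∧ rank A B i (j + 1) ≤ rank A B i j + 1) := by
  induction N with
  | zero =>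
    intro i j h
    obtain ⟨rfl, rfl⟩ : i = 0 ∧ j = 0 := by omega
    simp
  | succ N ih =>
    intro i j h
    constructor
    · cases j with
      | zero => simp
      | succ j =>
        have h₁ := ih i j (by omega)
        by_cases hm : IsMatch A B (i + 1) (j + 1)
        · rw [rank_of_isMatch hm]; omega
        · rw [rank_of_not_isMatch hm]; omega
    · cases i with
      | zero => simp
      | succ i =>
        have h₁ := ih i j (by omega)
        by_cases hm : IsMatch A B (i + 1) (j + 1)
        · rw [rank_of_isMatch hm]; omega
        · rw [rank_of_not_isMatch hm]; omega

theorem rank_mono {i j i' j' : ℕ} (hi : i ≤ i') (hj : j ≤ j') :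
    rank A B i j ≤ rank A B i' j' :=
  (monotone_nat_of_le_succ (f := fun i => rank A B i j)
      (fun n => (rank_steps _ n j le_rfl).1.1) hi).trans
    (monotone_nat_of_le_succ (f := fun j => rank A B i' j)
      (fun n => (rank_steps _ i' n le_rfl).2.1) hj)

theorem IsMatch.pos {i j : ℕ} (h : IsMatch A B i j) : 0 < i ∧ 0 < j := by
  constructor
  · by_contra h0
    obtain rfl : i = 0 := by omega
    exact not_isMatch_zero_left _ h
  · by_contra h0
    obtain rfl : j = 0 := by omega
    exact not_isMatch_zero_right _ h

theorem IsMatch.rank_eq {i j : ℕ} (h : IsMatch A B i j) :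
    rank A B i j = rank A B (i - 1) (j - 1) + 1 := by
  obtain ⟨hi, hj⟩ := h.pos
  obtain ⟨i, rfl⟩ := Nat.exists_eq_add_of_lt hi
  obtain ⟨j, rfl⟩ := Nat.exists_eq_add_of_lt hj
  simp only [zero_add] at *
  exact rank_of_isMatch h

theorem IsMatch.rank_lt {i j i' j' : ℕ} (h : IsMatch A B i' j') (hi : i < i') (hj : j < j') :
    rank A B i j < rank A B i' j' := by
  rw [h.rank_eq]
  exact Nat.lt_succ_of_le (rank_mono (by omega) (by omega))

/-! ### Edges -/

/-- Otherwise `v` would be strictly above and to the left of the match `w`, forcing a smaller rank.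
The two base positions may differ, so that lists of different vertices can be compared. -/
theorem IsCandidate.row_le {i j i' j' : ℕ} {v w : Node} (hv : IsCandidate A B i j v)
    (hw : IsCandidate A B i' j' w) (hr : rank A B i j = rank A B i' j') (h : v.2 < w.2) :
    w.1 ≤ v.1 := by
  by_contra h'
  have := hw.2.2.1.rank_lt (not_le.1 h') h
  have := hv.2.2.2
  have := hw.2.2.2
  omega

theorem IsCandidate.col_le {i j i' j' : ℕ} {v w : Node} (hv : IsCandidate A B i j v)
    (hw : IsCandidate A B i' j' w) (hr : rank A B i j = rank A B i' j') (h : v.1 < w.1) :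
    w.2 ≤ v.2 := by
  by_contra h'
  exact absurd (hv.row_le hw hr (not_le.1 h')) (not_le.2 h)

theorem Edge.col_le {i j : ℕ} {v w : Node} (hv : Edge A B i j v) (hw : IsCandidate A B i j w)
    (h : w.1 = v.1) : w.2 ≤ v.2 := by
  by_contra h'
  exact hv.2 ⟨w, hw, Or.inl ⟨h, not_le.1 h'⟩⟩

theorem Edge.row_le {i j : ℕ} {v w : Node} (hv : Edge A B i j v) (hw : IsCandidate A B i j w)
    (h : w.2 = v.2) : w.1 ≤ v.1 := by
  by_contra h'
  exact hv.2 ⟨w, hw, Or.inr ⟨h, not_le.1 h'⟩⟩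

theorem edge_iff {i j : ℕ} {v : Node} : Edge A B i j v ↔ IsCandidate A B i j v ∧
    (∀ w, IsCandidate A B i j w → w.1 = v.1 → w.2 ≤ v.2) ∧
    (∀ w, IsCandidate A B i j w → w.2 = v.2 → w.1 ≤ v.1) := by
  refine ⟨fun h => ⟨h.1, fun w => h.col_le, fun w => h.row_le⟩, fun h => ⟨h.1, ?_⟩⟩
  rintro ⟨w, hw, ⟨h₁, h₂⟩ | ⟨h₁, h₂⟩⟩
  · exact absurd (h.2.1 w hw h₁) (not_le.2 h₂)
  · exact absurd (h.2.2 w hw h₁) (not_le.2 h₂)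

theorem edge_congr {i j i' j' : ℕ} (h : ∀ w, IsCandidate A B i j w ↔ IsCandidate A B i' j' w)
    (v : Node) : Edge A B i j v ↔ Edge A B i' j' v := by
  simp only [edge_iff, h]

/-! ### Recurrences for the edges. -/

theorem not_edge_of_rank_eq_zero {i j : ℕ} (h : rank A B i j = 0) (v : Node) :
    ¬ Edge A B i j v := by
  intro hv
  have h₁ := hv.1.2.2.2
  rw [hv.1.2.2.1.rank_eq] at h₁
  omega

theorem edge_of_isMatch {i j : ℕ} (h : IsMatch A B i j) (v : Node) :
    Edge A B i j v ↔ v = (i, j) := by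
  have hc : IsCandidate A B i j (i, j) := ⟨le_rfl, le_rfl, h, rfl⟩
  constructor
  · intro hv
    have h₁ := hv.1.1
    have h₂ := hv.1.2.1
    rcases h₁.lt_or_eq with h₃ | h₃
    · have := hv.1.col_le hc rfl h₃
      have := hv.row_le hc (by simp at *; omega)
      simp at *; omega
    · have := hv.col_le hc h₃.symm
      exact Prod.ext h₃ (by simp at *; omega)
  · rintro rfl
    exact edge_iff.2 ⟨hc, fun w hw _ => hw.2.1, fun w hw _ => hw.1⟩

/-- A candidate in the new row would lie in a column at most `j`, the corner being no match, and its
rank would be bounded by that of the left neighbour, which is too small. -/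
theorem edge_of_lt_up {i j : ℕ} (hm : ¬ IsMatch A B (i + 1) (j + 1))
    (h : rank A B (i + 1) j < rank A B i (j + 1)) (v : Node) :
    Edge A B (i + 1) (j + 1) v ↔ Edge A B i (j + 1) v := by
  have hr : rank A B (i + 1) (j + 1) = rank A B i (j + 1) := by
    rw [rank_of_not_isMatch hm]; omega
  refine edge_congr (fun w => ⟨fun hw => ?_, fun hw => ?_⟩) v
  · obtain ⟨h₁, h₂, h₃, h₄⟩ := hw
    refine ⟨?_, h₂, h₃, h₄.trans hr⟩
    by_contra h₅
    obtain ⟨w₁, w₂⟩ := w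
    obtain rfl : w₁ = i + 1 := by simp at *; omega
    rcases h₂.lt_or_eq with h₆ | h₆
    · have := rank_mono (A := A) (B := B) (le_refl (i + 1)) (Nat.le_of_lt_succ h₆)
      simp at *; omega
    · simp only at h₆ h₃; exact hm (h₆ ▸ h₃)
  · exact ⟨hw.1.trans (Nat.le_succ i), hw.2.1, hw.2.2.1, hw.2.2.2.trans hr.symm⟩

theorem edge_of_lt_left {i j : ℕ} (hm : ¬ IsMatch A B (i + 1) (j + 1))
    (h : rank A B i (j + 1) < rank A B (i + 1) j) (v : Node) :
    Edge A B (i + 1) (j + 1) v ↔ Edge A B (i + 1) j v := by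
  have hr : rank A B (i + 1) (j + 1) = rank A B (i + 1) j := by
    rw [rank_of_not_isMatch hm]; omega
  refine edge_congr (fun w => ⟨fun hw => ?_, fun hw => ?_⟩) v
  · obtain ⟨h₁, h₂, h₃, h₄⟩ := hw
    refine ⟨h₁, ?_, h₃, h₄.trans hr⟩
    by_contra h₅
    obtain ⟨w₁, w₂⟩ := w
    obtain rfl : w₂ = j + 1 := by simp at *; omega
    rcases h₁.lt_or_eq with h₆ | h₆
    · have := rank_mono (A := A) (B := B) (Nat.le_of_lt_succ h₆) (le_refl (j + 1))
      simp at *; omega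
    · simp only at h₆ h₃; exact hm (h₆ ▸ h₃)
  · exact ⟨hw.1, hw.2.1.trans (Nat.le_succ j), hw.2.2.1, hw.2.2.2.trans hr.symm⟩

theorem isCandidate_iff_of_eq {i j : ℕ} (hm : ¬ IsMatch A B (i + 1) (j + 1))
    (h : rank A B i (j + 1) = rank A B (i + 1) j) (w : Node) :
    IsCandidate A B (i + 1) (j + 1) w ↔
      IsCandidate A B i (j + 1) w ∨ IsCandidate A B (i + 1) j w := by
  have hr : rank A B (i + 1) (j + 1) = rank A B (i + 1) j := by
    rw [rank_of_not_isMatch hm]; omega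
  unfold IsCandidate
  rw [h, hr]
  constructor
  · rintro ⟨h₁, h₂, h₃, h₄⟩
    by_cases h₅ : w.1 ≤ i
    · exact Or.inl ⟨h₅, h₂, h₃, h₄⟩
    · by_cases h₆ : w.2 ≤ j
      · exact Or.inr ⟨h₁, h₆, h₃, h₄⟩
      · obtain ⟨h₇, h₈⟩ : w.1 = i + 1 ∧ w.2 = j + 1 := by omega
        rw [h₇, h₈] at h₃
        exact absurd h₃ hm
  · rintro (⟨h₁, h₂, h₃, h₄⟩ | ⟨h₁, h₂, h₃, h₄⟩)
    · exact ⟨h₁.trans (Nat.le_succ i), h₂, h₃, h₄⟩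
    · exact ⟨h₁, h₂.trans (Nat.le_succ j), h₃, h₄⟩

/-- The lowest candidate in the last column is antidominant, since nothing lies to its right. -/
theorem exists_edge_last_col {i j : ℕ} {w : Node} (hw : IsCandidate A B i j w) (h : w.2 = j) :
    ∃ v, Edge A B i j v ∧ v.2 = j := by
  classical
  have hP : IsCandidate A B i j (w.1, j) := by rw [← h] at hw ⊢; exact hw
  set r := Nat.findGreatest (fun r => IsCandidate A B i j (r, j)) i with hr
  have hs : IsCandidate A B i j (r, j) :=
    Nat.findGreatest_spec (P := fun r => IsCandidate A B i j (r, j)) hw.1 hP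
  refine ⟨(r, j), edge_iff.2 ⟨hs, fun x hx _ => hx.2.1, fun x hx hx' => ?_⟩, rfl⟩
  refine Nat.le_findGreatest hx.1 ?_
  simp only at hx'
  rw [← hx'] at hx ⊢
  exact hx

theorem edge_of_eq_of_no_last_col {i j : ℕ} (hm : ¬ IsMatch A B (i + 1) (j + 1))
    (h : rank A B i (j + 1) = rank A B (i + 1) j)
    (hy : ∀ y, Edge A B i (j + 1) y → y.2 ≠ j + 1) (v : Node) :
    Edge A B (i + 1) (j + 1) v ↔ Edge A B (i + 1) j v := by
  refine edge_congr (fun w => ?_) v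
  rw [isCandidate_iff_of_eq hm h]
  refine ⟨fun hw => hw.elim (fun hw => ?_) id, Or.inr⟩
  have h₁ : w.2 ≠ j + 1 := fun h₁ => by
    obtain ⟨y, hy₁, hy₂⟩ := exists_edge_last_col hw h₁
    exact hy y hy₁ hy₂
  have := hw.2.1
  exact ⟨hw.1.trans (Nat.le_succ i), by omega, hw.2.2.1, hw.2.2.2.trans h⟩

theorem edge_of_eq_of_last_col {i j : ℕ} (hm : ¬ IsMatch A B (i + 1) (j + 1))
    (h : rank A B i (j + 1) = rank A B (i + 1) j) {y : Node} (hy : Edge A B i (j + 1) y)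
    (hyj : y.2 = j + 1) (v : Node) :
    Edge A B (i + 1) (j + 1) v ↔ (Edge A B (i + 1) j v ∧ v.1 ≠ y.1) ∨ v = y := by
  have hc := isCandidate_iff_of_eq hm h
  have hcol : ∀ w, IsCandidate A B (i + 1) (j + 1) w → w.2 = j + 1 →
      IsCandidate A B i (j + 1) w := fun w hw hwj =>
    ((hc w).1 hw).elim id fun hw' => by have := hw'.2.1; omega
  have hyc : IsCandidate A B (i + 1) (j + 1) y := (hc y).2 (Or.inl hy.1)
  constructor
  · intro hv
    by_cases hvj : v.2 = j + 1
    · right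
      have h₁ := hy.row_le (hcol v hv.1 hvj) (hvj.trans hyj.symm)
      have h₂ := hv.row_le hyc (hyj.trans hvj.symm)
      exact Prod.ext (le_antisymm h₁ h₂) (hvj.trans hyj.symm)
    · left
      have hv' : IsCandidate A B (i + 1) j v := ((hc v).1 hv.1).elim
        (fun hw => ⟨hw.1.trans (Nat.le_succ i), by have := hw.2.1; omega, hw.2.2.1,
          hw.2.2.2.trans h⟩) id
      refine ⟨edge_iff.2 ⟨hv', fun w hw => hv.col_le ((hc w).2 (Or.inr hw)),
        fun w hw => hv.row_le ((hc w).2 (Or.inr hw))⟩, fun h' => ?_⟩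
      have h₁ := hv.col_le hyc h'.symm
      have := hv'.2.1
      omega
  · rintro (⟨hv, hvy⟩ | rfl)
    · refine edge_iff.2 ⟨(hc v).2 (Or.inr hv.1), fun w hw hwv => ?_, fun w hw hwv => ?_⟩
      · by_cases hwj : w.2 = j + 1
        · exfalso
          have h₁ := hy.row_le (hcol w hw hwj) (hwj.trans hyj.symm)
          have h₂ := hv.1.row_le hy.1 h.symm (by have := hv.1.2.1; omega)
          omega
        · refine hv.col_le (((hc w).1 hw).elim (fun hw => ?_) id) hwv
          exact ⟨hw.1.trans (Nat.le_succ i), by have := hw.2.1; omega, hw.2.2.1,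
            hw.2.2.2.trans h⟩
      · refine hv.row_le (((hc w).1 hw).elim (fun hw => ?_) id) hwv
        exact ⟨hw.1.trans (Nat.le_succ i), by have := hv.1.2.1; omega, hw.2.2.1,
            hw.2.2.2.trans h⟩
    · refine edge_iff.2 ⟨hyc, fun w hw _ => ?_, fun w hw hwv => ?_⟩
      · rw [hyj]; exact hw.2.1
      · exact hy.row_le (hcol w hw (hwv.trans hyj)) hwv

/-! ### Adjacency lists -/

theorem IsAdjacencyList.nodup {i j : ℕ} {l : List Node} (h : IsAdjacencyList A B i j l) :
    l.Nodup :=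
  h.2.imp fun hab hne => by rw [hne] at hab; exact lt_irrefl _ hab.1

theorem IsAdjacencyList.congr {i j i' j' : ℕ} {l : List Node} (h : IsAdjacencyList A B i j l)
    (he : ∀ v, Edge A B i' j' v ↔ Edge A B i j v) : IsAdjacencyList A B i' j' l :=
  ⟨fun v => (h.1 v).trans (he v).symm, h.2⟩

theorem isAdjacencyList_nil {i j : ℕ} (h : rank A B i j = 0) : IsAdjacencyList A B i j [] :=
  ⟨fun v => by simp [not_edge_of_rank_eq_zero h v], List.Pairwise.nil⟩

theorem isAdjacencyList_singleton {i j : ℕ} (h : IsMatch A B i j) :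
    IsAdjacencyList A B i j [(i, j)] :=
  ⟨fun v => by simp [edge_of_isMatch h v], List.pairwise_singleton _ _⟩

/-- `q` follows `p` in an adjacency list, and is not the last node of that list. -/
def IsLink (A B : List α) (p q : Node) : Prop :=
  ∃ (i j : ℕ) (l l₁ l₂ : List Node), IsAdjacencyList A B i j l ∧ l = l₁ ++ p :: q :: l₂ ∧ l₂ ≠ []

/-- The neighbours `p` and `r'` shield `q'`. A candidate for `[i, j]` in the row of `q'` lies no
further right than `r'`, and one in the column of `q'` no lower than `p`. Both are therefore
candidates for `[i', j']` and cannot beat `q'`. So `q'` is antidominant for `[i, j]` too, and it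
lies beyond `p` but in a column not exceeding that of `q`, where the list has no node but `q`. -/
theorem IsLink.unique_aux {i j i' j' : ℕ} {l₁ l₂ : List Node} {p q q' r' : Node}
    (hl : IsAdjacencyList A B i j (l₁ ++ p :: q :: l₂)) (hp' : Edge A B i' j' p)
    (hq' : Edge A B i' j' q') (hr' : Edge A B i' j' r') (hpq : q'.1 < p.1 ∧ p.2 < q'.2)
    (hqr : r'.1 < q'.1 ∧ q'.2 < r'.2) (h : q'.2 ≤ q.2) : q' = q := by
  have hp : Edge A B i j p := (hl.1 p).1 (by simp)
  have hq : Edge A B i j q := (hl.1 q).1 (by simp)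
  have hrk : rank A B i j = rank A B i' j' := hp.1.2.2.2.symm.trans hp'.1.2.2.2
  have hc : IsCandidate A B i j q' :=
    ⟨hpq.1.le.trans hp.1.1, h.trans hq.1.2.1, hq'.1.2.2.1, hq'.1.2.2.2.trans hrk.symm⟩
  have he : Edge A B i j q' := by
    refine edge_iff.2 ⟨hc, fun w hw hwq => ?_, fun w hw hwq => ?_⟩
    · have h₁ := hr'.1.col_le hw hrk.symm (by omega)
      refine hq'.col_le ⟨by have := hq'.1.1; omega, h₁.trans hr'.1.2.1, hw.2.2.1, ?_⟩ hwq
      exact hw.2.2.2.trans hrk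
    · have h₁ := hp'.1.row_le hw hrk.symm (by omega)
      refine hq'.row_le ⟨h₁.trans hp'.1.1, by have := hq'.1.2.1; omega, hw.2.2.1, ?_⟩ hwq
      exact hw.2.2.2.trans hrk
  have hmem := (hl.1 q').2 he
  have hpw := hl.2
  simp only [List.pairwise_append, List.pairwise_cons, List.mem_append, List.mem_cons] at hmem hpw
  obtain ⟨-, ⟨-, h₂, -⟩, h₃⟩ := hpw
  rcases hmem with hm | rfl | rfl | hm
  · have := h₃ _ hm p (Or.inl rfl); omega
  · omega
  · rfl
  · have := h₂ _ hm; omega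

theorem IsLink.unique {p q q' : Node} (h : IsLink A B p q) (h' : IsLink A B p q') : q = q' := by
  obtain ⟨i, j, _, l₁, l₂, hl, rfl, hne⟩ := h
  obtain ⟨i', j', _, l₁', l₂', hl', rfl, hne'⟩ := h'
  obtain ⟨r, l₂, rfl⟩ := List.exists_cons_of_ne_nil hne
  obtain ⟨r', l₂', rfl⟩ := List.exists_cons_of_ne_nil hne'
  have h₁ := hl.2
  have h₁' := hl'.2
  simp only [List.pairwise_append, List.pairwise_cons, List.mem_cons] at h₁ h₁'
  rcases le_total q'.2 q.2 with h | h
  · exact (IsLink.unique_aux hl ((hl'.1 _).1 (by simp)) ((hl'.1 _).1 (by simp))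
      ((hl'.1 r').1 (by simp)) (h₁'.2.1.1 _ (by simp)) (h₁'.2.1.2.1 _ (by simp)) h).symm
  · exact IsLink.unique_aux hl' ((hl.1 _).1 (by simp)) ((hl.1 _).1 (by simp))
      ((hl.1 r).1 (by simp)) (h₁.2.1.1 _ (by simp)) (h₁.2.1.2.1 _ (by simp)) h

theorem IsAdjacencyList.concat {i j : ℕ} {l : List Node} {y : Node}
    (hm : ¬ IsMatch A B (i + 1) (j + 1)) (h : rank A B i (j + 1) = rank A B (i + 1) j)
    (hy : Edge A B i (j + 1) y) (hyj : y.2 = j + 1) (hl : IsAdjacencyList A B (i + 1) j l)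
    (hne : ∀ v ∈ l, v.1 ≠ y.1) : IsAdjacencyList A B (i + 1) (j + 1) (l ++ [y]) := by
  constructor
  · intro v
    rw [edge_of_eq_of_last_col hm h hy hyj, ← hl.1]
    have := hne v
    simp only [List.mem_append, List.mem_singleton]
    tauto
  · refine List.pairwise_append.2 ⟨hl.2, List.pairwise_singleton _ _, fun v hv w hw => ?_⟩
    obtain rfl := List.mem_singleton.1 hw
    have he := (hl.1 v).1 hv
    have h₂ : v.2 < w.2 := by have := he.1.2.1; omega
    have := he.1.row_le hy.1 h.symm h₂
    have := hne v hv
    exact ⟨by omega, h₂⟩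

/-- No node of the left list lies above the row of `y`, and rows strictly decrease along the list,
so only its last node can share that row. -/
theorem IsAdjacencyList.row_ne {i j : ℕ} {us : List Node} {x y : Node}
    (h : rank A B i (j + 1) = rank A B (i + 1) j)
    (hy : Edge A B i (j + 1) y) (hyj : y.2 = j + 1) (hl : IsAdjacencyList A B (i + 1) j (us ++ [x]))
    : ∀ v ∈ us, v.1 ≠ y.1 := by
  intro v hv
  have h₁ := (List.pairwise_append.1 hl.2).2.2 v hv x (by simp)
  have he := (hl.1 x).1 (by simp)
  have := he.1.row_le hy.1 h.symm (by have := he.1.2.1; omega)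
  omega

theorem IsAdjacencyList.replace_last {i j : ℕ} {us : List Node} {x y : Node}
    (hm : ¬ IsMatch A B (i + 1) (j + 1)) (h : rank A B i (j + 1) = rank A B (i + 1) j)
    (hy : Edge A B i (j + 1) y) (hyj : y.2 = j + 1) (hl : IsAdjacencyList A B (i + 1) j (us ++ [x]))
    (hxy : x.1 = y.1) : IsAdjacencyList A B (i + 1) (j + 1) (us ++ [y]) := by
  have hne := hl.row_ne h hy hyj
  constructor
  · intro v
    rw [edge_of_eq_of_last_col hm h hy hyj, ← hl.1]
    have := hne v
    simp only [List.mem_append, List.mem_singleton]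
    constructor
    · tauto
    · rintro (⟨h₁ | rfl, h₂⟩ | h₁) <;> tauto
  · refine List.pairwise_append.2 ⟨(List.pairwise_append.1 hl.2).1, List.pairwise_singleton _ _,
      fun v hv w hw => ?_⟩
    obtain rfl := List.mem_singleton.1 hw
    have he := (hl.1 v).1 (by simp [hv])
    have h₂ : v.2 < w.2 := by have := he.1.2.1; omega
    have := he.1.row_le hy.1 h.symm h₂
    have := hne v hv
    exact ⟨by omega, h₂⟩

/-! ### Ranks and longest common subsequences -/

theorem take_succ_eq (A : List α) (i : ℕ) :
    A.take (i + 1) = A.take i ++ (symAt A (i + 1)).toList :=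
  List.take_add_one

theorem take_sublist_take {i i' : ℕ} (h : i ≤ i') : (A.take i).Sublist (A.take i') :=
  (List.take_prefix_take_left h).sublist

theorem concat_sublist_take {w : List α} {c : α} {i : ℕ} (hc : symAt A i = some c)
    (h : w.Sublist (A.take (i - 1))) : (w ++ [c]).Sublist (A.take i) := by
  cases i with
  | zero => simp [symAt] at hc
  | succ i =>
    rw [take_succ_eq, hc]
    exact List.Sublist.append h (List.Sublist.refl _)

/-- The final `c` may be assigned to the last symbol of the prefix whenever that symbol is `c`;
otherwise that symbol is not needed. -/
theorem sublist_take_succ {w : List α} {c : α} {i : ℕ}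
    (h : (w ++ [c]).Sublist (A.take (i + 1))) :
    (symAt A (i + 1) = some c ∧ w.Sublist (A.take i)) ∨
      (symAt A (i + 1) ≠ some c ∧ (w ++ [c]).Sublist (A.take i)) := by
  rw [take_succ_eq] at h
  cases hs : symAt A (i + 1) with
  | none => right; simpa [hs] using h
  | some d =>
    rw [hs, Option.toList_some] at h
    by_cases hd : d = c
    · subst hd
      exact Or.inl ⟨rfl, (List.append_sublist_append_right _).1 h⟩
    · refine Or.inr ⟨by simpa using hd, ?_⟩
      obtain ⟨l₁, l₂, h₁, h₂, h₃⟩ := List.sublist_append_iff.1 h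
      rcases List.eq_nil_or_concat l₂ with rfl | ⟨l, e, rfl⟩
      · rw [h₁, List.append_nil]; exact h₂
      · exfalso
        have h₄ : e ∈ [d] := h₃.subset (by simp)
        rw [List.mem_singleton] at h₄
        rw [List.concat_eq_append, ← List.append_assoc] at h₁
        have := List.append_inj_right' h₁ rfl
        simp at this
        exact hd (h₄ ▸ this.symm)

theorem length_le_rank : ∀ (i j : ℕ) (v : List α), v.Sublist (A.take i) → v.Sublist (B.take j) →
    v.length ≤ rank A B i j := by
  intro i
  induction i with
  | zero => intro j v h _; simp at h; simp [h]
  | succ i ihi =>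
    intro j
    induction j with
    | zero => intro v _ h; simp at h; simp [h]
    | succ j ihj =>
      intro v hA hB
      rcases List.eq_nil_or_concat v with rfl | ⟨w, c, rfl⟩
      · simp
      rw [List.concat_eq_append] at *
      rcases sublist_take_succ hA with ⟨hcA, hwA⟩ | ⟨-, hA'⟩
      · rcases sublist_take_succ hB with ⟨hcB, hwB⟩ | ⟨-, hB'⟩
        · rw [rank_of_isMatch ⟨c, hcA, hcB⟩]
          simpa using ihi j w hwA hwB
        · exact (ihj _ hA hB').trans (rank_mono le_rfl (Nat.le_succ j))
      · exact (ihi _ _ hA' hB).trans (rank_mono (Nat.le_succ i) le_rfl)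

theorem exists_length_eq_rank : ∀ (i j : ℕ), ∃ v : List α, v.Sublist (A.take i) ∧
    v.Sublist (B.take j) ∧ v.length = rank A B i j := by
  intro i
  induction i with
  | zero => intro j; exact ⟨[], by simp⟩
  | succ i ihi =>
    intro j
    induction j with
    | zero => exact ⟨[], by simp⟩
    | succ j ihj =>
      by_cases hm : IsMatch A B (i + 1) (j + 1)
      · obtain ⟨v, hA, hB, hv⟩ := ihi j
        rw [rank_of_isMatch hm]
        obtain ⟨c, hcA, hcB⟩ := hm
        exact ⟨v ++ [c], concat_sublist_take hcA hA, concat_sublist_take hcB hB, by simp [hv]⟩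
      · rw [rank_of_not_isMatch hm]
        rcases le_total (rank A B i (j + 1)) (rank A B (i + 1) j) with h | h
        · obtain ⟨v, hA, hB, hv⟩ := ihj
          exact ⟨v, hA, hB.trans (take_sublist_take (Nat.le_succ j)), by rw [hv, max_eq_right h]⟩
        · obtain ⟨v, hA, hB, hv⟩ := ihi (j + 1)
          exact ⟨v, hA.trans (take_sublist_take (Nat.le_succ i)), hB, by rw [hv, max_eq_left h]⟩

theorem isLCS_take_iff {w : List α} {i j : ℕ} : IsLCS w (A.take i) (B.take j) ↔
    w.Sublist (A.take i) ∧ w.Sublist (B.take j) ∧ w.length = rank A B i j := by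
  refine and_congr_right fun hA => and_congr_right fun hB => ⟨fun h => ?_, fun h v hvA hvB => ?_⟩
  · obtain ⟨v, hvA, hvB, hv⟩ := exists_length_eq_rank (A := A) (B := B) i j
    exact le_antisymm (length_le_rank i j w hA hB) (hv ▸ h v hvA hvB)
  · rw [h]; exact length_le_rank i j v hvA hvB

theorem exists_isLCS (i j : ℕ) : ∃ w, IsLCS w (A.take i) (B.take j) :=
  (exists_length_eq_rank i j).imp fun _ h => isLCS_take_iff.2 h

theorem exists_last_occurrence {w : List α} {c : α} : ∀ {i : ℕ},
    (w ++ [c]).Sublist (A.take i) → ∃ r ≤ i, symAt A r = some c ∧ w.Sublist (A.take (r - 1)) ∧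
      ∀ r' ≤ i, symAt A r' = some c → r' ≤ r := by
  intro i
  induction i with
  | zero => intro h; simp at h
  | succ i ih =>
    intro h
    rcases sublist_take_succ h with ⟨hc, hw⟩ | ⟨hc, hw⟩
    · exact ⟨i + 1, le_rfl, hc, hw, fun r' h _ => h⟩
    · obtain ⟨r, hr, hrc, hrw, hmax⟩ := ih hw
      refine ⟨r, by omega, hrc, hrw, fun r' hr' hc' => ?_⟩
      rcases Nat.le_succ_iff.1 hr' with h' | rfl
      · exact hmax r' h' hc'
      · exact absurd hc' hc

theorem isLCS_iff_exists_edge {w : List α} {i j : ℕ} (hr : rank A B i j ≠ 0) :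
    IsLCS w (A.take i) (B.take j) ↔ ∃ v c w', Edge A B i j v ∧ symAt A v.1 = some c ∧
      w = w' ++ [c] ∧ IsLCS w' (A.take (v.1 - 1)) (B.take (v.2 - 1)) := by
  simp only [isLCS_take_iff]
  constructor
  · rintro ⟨hA, hB, hw⟩
    rcases List.eq_nil_or_concat w with rfl | ⟨w, c, rfl⟩
    · exact absurd hw.symm hr
    rw [List.concat_eq_append] at *
    obtain ⟨r, hri, hrc, hrw, hrm⟩ := exists_last_occurrence hA
    obtain ⟨q, hqj, hqc, hqw, hqm⟩ := exists_last_occurrence hB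
    have hm : IsMatch A B r q := ⟨c, hrc, hqc⟩
    -- The rank of `(r, q)` is squeezed: from below by the string `w` in front of it, from above by
    -- monotonicity.
    have h₁ := length_le_rank _ _ w hrw hqw
    have h₂ := hm.rank_eq
    have h₃ := rank_mono (A := A) (B := B) hri hqj
    simp only [List.length_append, List.length_singleton] at hw
    have hk : rank A B r q = rank A B i j := by omega
    refine ⟨(r, q), c, w, edge_iff.2 ⟨⟨hri, hqj, hm, hk⟩, ?_, ?_⟩, hrc, rfl, hrw, hqw,
      by simp only; omega⟩
    · rintro ⟨r', q'⟩ ⟨-, h₄, ⟨d, hd₁, hd₂⟩, -⟩ h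
      simp only at *
      subst h
      exact hqm _ h₄ (by rw [hd₂, ← hd₁, hrc])
    · rintro ⟨r', q'⟩ ⟨h₄, -, ⟨d, hd₁, hd₂⟩, -⟩ h
      simp only at *
      subst h
      exact hrm _ h₄ (by rw [hd₁, ← hd₂, hqc])
  · rintro ⟨v, c, w', he, hc, rfl, hA, hB, hw⟩
    obtain ⟨⟨hi, hj, hm, hk⟩, -⟩ := he
    have hcB : symAt B v.2 = some c := by
      obtain ⟨d, h₁, h₂⟩ := hm
      rw [h₂, ← h₁, hc]
    refine ⟨(concat_sublist_take hc hA).trans (take_sublist_take hi),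
      (concat_sublist_take hcB hB).trans (take_sublist_take hj), ?_⟩
    rw [← hk, hm.rank_eq, ← hw]
    simp

/-- A later occurrence of the same symbol would give a match below `v` in its column, of the same
rank by monotonicity, against antidominance. -/
theorem Edge.row_maximal {i j r : ℕ} {v : Node} (hv : Edge A B i j v) (hr : r ≤ i)
    (h : symAt A r = symAt A v.1) : r ≤ v.1 := by
  by_contra h'
  have hm : IsMatch A B r v.2 := by
    obtain ⟨c, h₁, h₂⟩ := hv.1.2.2.1
    exact ⟨c, h.trans h₁, h₂⟩
  have h₁ := rank_mono (A := A) (B := B) (not_le.1 h').le (le_refl v.2)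
  have h₂ := rank_mono (A := A) (B := B) hr hv.1.2.1
  exact h' (hv.row_le (w := (r, v.2)) ⟨hr, hv.1.2.1, hm, le_antisymm h₂ (hv.1.2.2.2 ▸ h₁)⟩ rfl)

theorem Edge.col_maximal {i j r : ℕ} {v : Node} (hv : Edge A B i j v) (hr : r ≤ j)
    (h : symAt B r = symAt B v.2) : r ≤ v.2 := by
  by_contra h'
  have hm : IsMatch A B v.1 r := by
    obtain ⟨c, h₁, h₂⟩ := hv.1.2.2.1
    exact ⟨c, h₁, h.trans h₂⟩
  have h₁ := rank_mono (A := A) (B := B) (le_refl v.1) (not_le.1 h').le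
  have h₂ := rank_mono (A := A) (B := B) hv.1.1 hr
  exact h' (hv.col_le (w := (v.1, r)) ⟨hv.1.1, hr, hm, le_antisymm h₂ (hv.1.2.2.2 ▸ h₁)⟩ rfl)

theorem Edge.eq_of_symAt_eq {i j : ℕ} {v w : Node} (hv : Edge A B i j v) (hw : Edge A B i j w)
    (h : symAt A v.1 = symAt A w.1) : v = w := by
  have h' : symAt B v.2 = symAt B w.2 := by
    obtain ⟨c, h₁, h₂⟩ := hv.1.2.2.1
    obtain ⟨d, h₃, h₄⟩ := hw.1.2.2.1
    rw [h₂, ← h₁, h, h₃, h₄]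
  exact Prod.ext (le_antisymm (hw.row_maximal hv.1.1 h) (hv.row_maximal hw.1.1 h.symm))
    (le_antisymm (hw.col_maximal hv.1.2.1 h') (hv.col_maximal hw.1.2.1 h'.symm))

/-! ### Enumerating the longest common subsequences along the graph -/

/-- The strings spelled by the paths of `l` nodes that start from the vertex `[i, j]`, where `adj`
gives the adjacency lists. -/
def words (A : List α) (adj : ℕ → ℕ → List Node) : ℕ → ℕ → ℕ → List (List α)
  | 0, _, _ => [[]]
  | l + 1, i, j => (adj i j).flatMap fun v =>
      (words A adj l (v.1 - 1) (v.2 - 1)).map (· ++ (symAt A v.1).toList)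

variable {adj : ℕ → ℕ → List Node}

theorem mem_words (hadj : ∀ i j, i ≤ A.length → j ≤ B.length → IsAdjacencyList A B i j (adj i j)) :
    ∀ l i j, i ≤ A.length → j ≤ B.length → rank A B i j = l → ∀ w,
      w ∈ words A adj l i j ↔ IsLCS w (A.take i) (B.take j) := by
  intro l
  induction l with
  | zero =>
    intro i j hi hj hr w
    rw [isLCS_take_iff, hr, words, List.mem_singleton, List.length_eq_zero_iff]
    constructor
    · rintro rfl; simp
    · exact fun h => h.2.2
  | succ l ih =>
    intro i j hi hj hr w
    rw [isLCS_iff_exists_edge (by omega), words]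
    simp only [List.mem_flatMap, List.mem_map]
    have key : ∀ v, Edge A B i j v → ∀ w', w' ∈ words A adj l (v.1 - 1) (v.2 - 1) ↔
        IsLCS w' (A.take (v.1 - 1)) (B.take (v.2 - 1)) := fun v hv w' => by
      have h₁ := hv.1.1
      have h₂ := hv.1.2.1
      have h₃ := hv.1.2.2.2
      rw [hv.1.2.2.1.rank_eq] at h₃
      exact ih _ _ (by omega) (by omega) (by omega) w'
    constructor
    · rintro ⟨v, hv, w', hw', rfl⟩
      have he := ((hadj i j hi hj).1 v).1 hv
      obtain ⟨c, hc, -⟩ := he.1.2.2.1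
      exact ⟨v, c, w', he, hc, by simp [hc], (key v he w').1 hw'⟩
    · rintro ⟨v, c, w', he, hc, rfl, hw'⟩
      exact ⟨v, ((hadj i j hi hj).1 v).2 he, w', (key v he w').2 hw', by simp [hc]⟩

theorem nodup_words
    (hadj : ∀ i j, i ≤ A.length → j ≤ B.length → IsAdjacencyList A B i j (adj i j)) :
    ∀ l i j, i ≤ A.length → j ≤ B.length → (words A adj l i j).Nodup := by
  intro l
  induction l with
  | zero => intro i j _ _; simp [words]
  | succ l ih =>
    intro i j hi hj
    have he := fun v => ((hadj i j hi hj).1 v).1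
    rw [words, List.nodup_flatMap]
    constructor
    · intro v hv
      have h₁ := (he v hv).1.1
      have h₂ := (he v hv).1.2.1
      exact (ih _ _ (by omega) (by omega)).map fun _ _ h => List.append_cancel_right h
    · refine (hadj i j hi hj).nodup.imp_of_mem fun {v w} hv hw hne => ?_
      rw [Function.onFun, List.disjoint_left]
      intro x hxv hxw
      obtain ⟨y, -, rfl⟩ := List.mem_map.1 hxv
      obtain ⟨z, -, h⟩ := List.mem_map.1 hxw
      obtain ⟨c, hc, -⟩ := (he v hv).1.2.2.1
      obtain ⟨d, hd, -⟩ := (he w hw).1.2.2.1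
      rw [hc, hd] at h
      have h₁ := List.append_inj_right' h rfl
      simp at h₁
      exact hne ((he v hv).eq_of_symAt_eq (he w hw) (by rw [hc, hd, h₁]))

theorem words_ne_nil
    (hadj : ∀ i j, i ≤ A.length → j ≤ B.length → IsAdjacencyList A B i j (adj i j))
    {i j : ℕ} (hi : i ≤ A.length) (hj : j ≤ B.length) : words A adj (rank A B i j) i j ≠ [] := by
  obtain ⟨w, hw⟩ := exists_isLCS (A := A) (B := B) i j
  exact List.ne_nil_of_mem ((mem_words hadj _ i j hi hj rfl w).2 hw)

theorem tape_append (ws ws' : List (List α)) : tape (ws ++ ws') = tape ws ++ tape ws' :=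
  List.flatMap_append

theorem length_tape {k : ℕ} {ws : List (List α)} (h : ∀ w ∈ ws, w.length = k) :
    (tape ws).length = ws.length * (k + 1) := by
  induction ws with
  | nil => simp [tape]
  | cons w ws ih =>
    rw [← List.singleton_append, tape_append, List.length_append,
      ih fun w hw => h w (List.mem_cons_of_mem _ hw)]
    simp [tape, h w]
    ring

/-! ### Storing the adjacency lists -/

/-- The pointers `h`, `p`, `t` to head, pretail and tail represent the list `l` with respect to
the link fields `next`. -/
def IsStored (next : Node → Ptr) (h p t : Ptr) (l : List Node) : Prop :=
  (l = [] ∧ t = none ∧ h = none) ∨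
  ∃ (us : List Node) (v : Node), l = us ++ [v] ∧ t = some v ∧
    h = us.head? ∧ (us ≠ [] → p = us.getLast?) ∧ us.IsChain (fun x y => next x = some y)

theorem isStored_nil (next : Node → Ptr) (p : Ptr) : IsStored next none p none [] :=
  Or.inl ⟨rfl, rfl, rfl⟩

theorem isStored_singleton (next : Node → Ptr) (p : Ptr) (v : Node) :
    IsStored next none p (some v) [v] :=
  Or.inr ⟨[], v, by simp⟩

theorem IsAdjacencyList.isChain_isLink {i j : ℕ} {us : List Node} {v : Node}
    (h : IsAdjacencyList A B i j (us ++ [v])) : us.IsChain (IsLink A B) := by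
  refine List.isChain_iff_forall_rel_of_append_cons_cons.2 fun {p q l₁ l₂} he => ?_
  exact ⟨i, j, _, l₁, l₂ ++ [v], h, by simp [he], by simp⟩

/-- If `x` has a stored link in `l`, its target is also a link from `x`, hence equals `y` by
uniqueness, and the write changes nothing there. -/
theorem IsStored.update {i j : ℕ} {next : Node → Ptr} {h p t : Ptr} {l : List Node} {x y : Node}
    (hs : IsStored next h p t l) (hl : IsAdjacencyList A B i j l) (hxy : IsLink A B x y) :
    IsStored (Function.update next x (some y)) h p t l := by
  rcases hs with hs | ⟨us, v, rfl, ht, hh, hp, hc⟩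
  · exact Or.inl hs
  · refine Or.inr ⟨us, v, rfl, ht, hh, hp, ?_⟩
    have h₁ := List.isChain_iff_forall_rel_of_append_cons_cons.1 hl.isChain_isLink
    rw [List.isChain_iff_forall_rel_of_append_cons_cons] at hc ⊢
    intro a b l₁ l₂ he
    by_cases ha : a = x
    · subst ha
      rw [Function.update_self, hxy.unique (h₁ he)]
    · rw [Function.update_of_ne ha]
      exact hc he

/-- The memory holds the rank and the adjacency list of `[i, j]`. -/
def State.HoldsAt (s : State α) (A B : List α) (i j : ℕ) : Prop :=
  s.rank i j = LCS.rank A B i j ∧ ∃ l, IsAdjacencyList A B i j l ∧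
    IsStored s.next (s.head i j) (s.pretail i j) (s.tail i j) l

theorem State.holdsGraph_iff {s : State α} : s.HoldsGraph A B ↔
    ∀ i j : ℕ, i ≤ A.length → j ≤ B.length → s.HoldsAt A B i j :=
  Iff.rfl

/-- The memory after the entries at `[i, j]` have been set. -/
def State.setEntry (s : State α) (i j r : ℕ) (h p t : Ptr) : State α :=
  { s with
    rank := write s.rank i j r
    head := write s.head i j h
    pretail := write s.pretail i j p
    tail := write s.tail i j t }

theorem write_self {β : Type} (f : ℕ → ℕ → β) (i j : ℕ) (x : β) : write f i j x i j = x := by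
  simp [write]

theorem write_of_ne {β : Type} (f : ℕ → ℕ → β) {i j i' j' : ℕ} (x : β) (h : i' = i → j' ≠ j) :
    write f i j x i' j' = f i' j' := by
  by_cases hi : i' = i
  · subst hi
    simp [write, h rfl]
  · simp [write, hi]

theorem State.HoldsAt.setEntry {s : State α} {i j i' j' r : ℕ} {h p t : Ptr}
    (hs : s.HoldsAt A B i' j') (hne : i' = i → j' ≠ j) :
    (s.setEntry i j r h p t).HoldsAt A B i' j' := by
  simpa only [State.HoldsAt, State.setEntry, write_of_ne _ _ hne] using hs

theorem State.holdsAt_setEntry {s : State α} {i j r : ℕ} {h p t : Ptr} {l : List Node}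
    (hr : r = LCS.rank A B i j) (hl : IsAdjacencyList A B i j l)
    (hs : IsStored s.next h p t l) : (s.setEntry i j r h p t).HoldsAt A B i j := by
  simp only [State.HoldsAt, State.setEntry, write_self]
  exact ⟨hr, l, hl, hs⟩

/-! ### The dynamic program -/

/-- Set the entries at the current position. -/
def setEntry (g : Exp .num) (p q r : Exp .ptr) : Cmd :=
  .seq (.setRank iReg jReg g) (.seq (.setHead iReg jReg p)
    (.seq (.setPretail iReg jReg q) (.setTail iReg jReg r)))

/-- The hypotheses say that no source pointer is affected by the earlier writes. The `12` is three
operations for each of the four writes. -/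
theorem exec_setEntry {s : State α} {g : Exp .num} {p q r : Exp .ptr}
    (hp : ∀ f, p.eval A B { s with rank := f } = p.eval A B s)
    (hq : ∀ f f', q.eval A B { s with rank := f, head := f' } = q.eval A B s)
    (hr : ∀ f f' f'', r.eval A B { s with rank := f, head := f', pretail := f'' } =
      r.eval A B s) :
    Exec A B (setEntry g p q r) s (s.setEntry (s.num 0) (s.num 1) (g.eval A B s)
        (p.eval A B s) (q.eval A B s) (r.eval A B s))
      (g.cost + p.cost + q.cost + r.cost + 12) := by
  have h := Exec.seq _ _ _ _ _ _ _ (Exec.setRank (A := A) (B := B) s iReg jReg g)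
    (Exec.seq _ _ _ _ _ _ _ (Exec.setHead _ iReg jReg p)
      (Exec.seq _ _ _ _ _ _ _ (Exec.setPretail _ iReg jReg q) (Exec.setTail _ iReg jReg r)))
  rw [hp, hq, hr] at h
  have ht : ∀ a b c d : ℕ, a + b + c + d + 12 =
      1 + 1 + a + 1 + (1 + 1 + b + 1 + (1 + 1 + c + 1 + (1 + 1 + d + 1))) := by
    intros; ring
  rw [ht]
  exact h

/-- The body of the dynamic program. -/
def cellStep : Cmd :=
  .ite (.isMatch iReg jReg)
    (setEntry (.succ (.rank (.pred iReg) (.pred jReg))) .null .null (.mk iReg jReg))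
    (.ite (.not (.and (.lt (.lit 0) iReg) (.lt (.lit 0) jReg)))
      (setEntry (.lit 0) .null .null .null)
      (.ite (.lt (.rank iReg (.pred jReg)) (.rank (.pred iReg) jReg))
        (setEntry (.rank (.pred iReg) jReg) (.head (.pred iReg) jReg) (.pretail (.pred iReg) jReg)
          (.tail (.pred iReg) jReg))
        (.ite (.and (.eq (.rank iReg (.pred jReg)) (.rank (.pred iReg) jReg))
            (.eq (.col (.tail (.pred iReg) jReg)) jReg))
          (.ite (.eq (.row (.tail iReg (.pred jReg))) (.row (.tail (.pred iReg) jReg)))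
            (setEntry (.rank iReg (.pred jReg)) (.head iReg (.pred jReg))
              (.pretail iReg (.pred jReg)) (.tail (.pred iReg) jReg))
            (.ite (.ptrEq (.head iReg (.pred jReg)) .null)
              (setEntry (.rank iReg (.pred jReg)) (.tail iReg (.pred jReg))
                (.tail iReg (.pred jReg)) (.tail (.pred iReg) jReg))
              (.seq (.setNext (.pretail iReg (.pred jReg)) (.tail iReg (.pred jReg)))
                (setEntry (.rank iReg (.pred jReg)) (.head iReg (.pred jReg))
                  (.tail iReg (.pred jReg)) (.tail (.pred iReg) jReg)))))
          (setEntry (.rank iReg (.pred jReg)) (.head iReg (.pred jReg))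
            (.pretail iReg (.pred jReg)) (.tail iReg (.pred jReg))))))

theorem isCellStep_cellStep : cellStep.IsCellStep := by
  simp [cellStep, setEntry, Cmd.IsCellStep, Cond.IsLocal, Exp.IsLocal, IsNeighbour]

/-- `s'` differs from `s` only in the entries at the position `[i, j]`, which are correct in `s'`,
and in link fields, whose changes do not damage the correct entries of `s`. -/
def Extends (A B : List α) (i j : ℕ) (s s' : State α) : Prop :=
  s'.num = s.num ∧ s'.HoldsAt A B i j ∧
    ∀ i' j', (i' = i → j' ≠ j) → s.HoldsAt A B i' j' → s'.HoldsAt A B i' j'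

theorem extends_setEntry {s : State α} {i j r : ℕ} {h p t : Ptr} {l : List Node}
    (hr : r = rank A B i j) (hl : IsAdjacencyList A B i j l)
    (hs : IsStored s.next h p t l) : Extends A B i j s (s.setEntry i j r h p t) :=
  ⟨rfl, State.holdsAt_setEntry hr hl hs, fun _ _ hne hs => hs.setEntry hne⟩

theorem extends_setEntry_link {s : State α} {i j r : ℕ} {h p t : Ptr} {l : List Node} {x y : Node}
    (hxy : IsLink A B x y) (hr : r = rank A B i j) (hl : IsAdjacencyList A B i j l)
    (hs : IsStored (Function.update s.next x (some y)) h p t l) : Extends A B i j s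
      ({ s with next := Function.update s.next x (some y) }.setEntry i j r h p t) := by
  refine ⟨rfl, State.holdsAt_setEntry hr hl hs, fun _ _ hne hs => State.HoldsAt.setEntry ?_ hne⟩
  obtain ⟨h₁, l', hl', hs'⟩ := hs
  exact ⟨h₁, l', hl', hs'.update hl' hxy⟩

theorem IsStored.eq_concat {next : Node → Ptr} {h p : Ptr} {v : Node} {l : List Node}
    (hs : IsStored next h p (some v) l) : ∃ us, l = us ++ [v] := by
  rcases hs with ⟨-, h, -⟩ | ⟨us, w, rfl, hw, -⟩
  · cases h
  · cases hw; exact ⟨us, rfl⟩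

theorem exec_cellStep_pos {s : State α} {i j : ℕ} (hi : s.num 0 = i + 1) (hj : s.num 1 = j + 1)
    (hm : ¬ IsMatch A B (i + 1) (j + 1)) (hup : s.HoldsAt A B i (j + 1))
    (hleft : s.HoldsAt A B (i + 1) j) :
    ∃ s' t, Exec A B cellStep s s' t ∧ t ≤ 200 ∧ Extends A B (i + 1) (j + 1) s s' := by
  obtain ⟨hru, lu, hlu, hsu⟩ := hup
  obtain ⟨hrl, ll, hll, hsl⟩ := hleft
  have hb₁ : ¬ (Cond.isMatch iReg jReg).Holds A B s := by
    simpa only [Cond.Holds, Exp.eval, hi, hj] using hm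
  have hb₂ : ¬ (Cond.not (.and (.lt (.lit 0) iReg) (.lt (.lit 0) jReg))).Holds A B s := by
    simp [Cond.Holds, Exp.eval, hi, hj]
  have hrk := rank_of_not_isMatch hm
  rcases lt_trichotomy (rank A B (i + 1) j) (rank A B i (j + 1)) with hlt | heq | hlt
  · refine ⟨_, _, .ite_neg _ _ _ _ _ _ hb₁ (.ite_neg _ _ _ _ _ _ hb₂ (.ite_pos _ _ _ _ _ _ ?_
      (exec_setEntry (fun _ => rfl) (fun _ _ => rfl) (fun _ _ _ => rfl)))), ?_, ?_⟩
    · simpa only [Cond.Holds, Exp.eval, hi, hj, Nat.add_sub_cancel, hru, hrl] using hlt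
    · simp [Cond.cost, Exp.cost]
    · simp only [Exp.eval, hi, hj, Nat.add_sub_cancel]
      exact extends_setEntry (by omega) (hlu.congr (edge_of_lt_up hm hlt)) hsu
  · have hb₃ : ¬ (Cond.lt (.rank iReg (.pred jReg)) (.rank (.pred iReg) jReg)).Holds A B s := by
      simp [Cond.Holds, Exp.eval, hi, hj, hru, hrl, heq]
    -- This agrees with the program's test, as the null pointer has column `0`.
    by_cases hcol : ∃ y, s.tail i (j + 1) = some y ∧ y.2 = j + 1
    · obtain ⟨y, hty, hyj⟩ := hcol
      have hy : Edge A B i (j + 1) y := by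
        rw [hty] at hsu
        obtain ⟨us, rfl⟩ := hsu.eq_concat
        exact (hlu.1 y).1 (by simp)
      have hb₄ : (Cond.and (.eq (.rank iReg (.pred jReg)) (.rank (.pred iReg) jReg))
          (.eq (.col (.tail (.pred iReg) jReg)) jReg)).Holds A B s := by
        simp [Cond.Holds, Exp.eval, hi, hj, hru, hrl, heq, hty, hyj]
      by_cases hrow : ∃ x, s.tail (i + 1) j = some x ∧ x.1 = y.1
      · obtain ⟨x, htx, hxy⟩ := hrow
        refine ⟨_, _, .ite_neg _ _ _ _ _ _ hb₁ (.ite_neg _ _ _ _ _ _ hb₂ (.ite_neg _ _ _ _ _ _ hb₃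
          (.ite_pos _ _ _ _ _ _ hb₄ (.ite_pos _ _ _ _ _ _ ?_
          (exec_setEntry (fun _ => rfl) (fun _ _ => rfl) (fun _ _ _ => rfl)))))), ?_, ?_⟩
        · simp [Cond.Holds, Exp.eval, hi, hj, htx, hty, hxy]
        · simp [Cond.cost, Exp.cost]
        · simp only [Exp.eval, hi, hj, Nat.add_sub_cancel]
          rw [htx] at hsl
          rcases hsl with ⟨-, h, -⟩ | ⟨us, x', rfl, hx', hh, hp, hc⟩
          · cases h
          cases hx'
          refine extends_setEntry (by omega) (hll.replace_last hm heq.symm hy hyj hxy) ?_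
          exact Or.inr ⟨us, y, rfl, hty, hh, hp, hc⟩
      · have hb₅ : ¬ (Cond.eq (.row (.tail iReg (.pred jReg)))
            (.row (.tail (.pred iReg) jReg))).Holds A B s := by
          simp only [Cond.Holds, Exp.eval, hi, hj, hty, Nat.add_sub_cancel]
          rcases h : s.tail (i + 1) j with _ | x
          -- A null tail has row `0`, whereas `y`, being a match, has a positive row.
          · have := hy.1.2.2.1.pos.1
            exact this.ne
          · simpa [h] using hrow
        -- A null head means at most one node in the left list; its old tail becomes both head and
        -- pretail.
        by_cases hh0 : s.head (i + 1) j = none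
        · refine ⟨_, _, .ite_neg _ _ _ _ _ _ hb₁ (.ite_neg _ _ _ _ _ _ hb₂
            (.ite_neg _ _ _ _ _ _ hb₃ (.ite_pos _ _ _ _ _ _ hb₄ (.ite_neg _ _ _ _ _ _ hb₅
            (.ite_pos _ _ _ _ _ _ ?_
            (exec_setEntry (fun _ => rfl) (fun _ _ => rfl) (fun _ _ _ => rfl))))))), ?_, ?_⟩
          · simp [Cond.Holds, Exp.eval, hi, hj, hh0]
          · simp [Cond.cost, Exp.cost]
          · simp only [Exp.eval, hi, hj, Nat.add_sub_cancel]
            rcases hsl with ⟨rfl, ht, -⟩ | ⟨us, x, rfl, hx, hh, hp, hc⟩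
            · refine extends_setEntry (by omega) (hll.concat hm heq.symm hy hyj (by simp)) ?_
              rw [ht, hty]
              exact isStored_singleton _ _ _
            · obtain rfl : us = [] := List.head?_eq_none_iff.1 (hh.symm.trans hh0)
              refine extends_setEntry (by omega) (hll.concat hm heq.symm hy hyj ?_) ?_
              · intro v hv h
                obtain rfl : v = x := by simpa using hv
                exact hrow ⟨v, hx, h⟩
              · exact Or.inr ⟨[x], y, by simp [hx, hty]⟩
        · rcases hsl with ⟨rfl, ht, hh⟩ | ⟨us, x, rfl, hx, hh, hp, hc⟩
          · exact absurd hh hh0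
          have hus : us ≠ [] := by rintro rfl; exact hh0 (by simpa using hh)
          obtain ⟨us', p, rfl⟩ := (List.eq_nil_or_concat us).resolve_left hus
          simp only [List.concat_eq_append] at *
          have hp' : s.pretail (i + 1) j = some p := by simpa using hp hus
          have hne : ∀ v ∈ us' ++ [p] ++ [x], v.1 ≠ y.1 := by
            intro v hv
            rcases List.mem_append.1 hv with hv | hv
            · exact hll.row_ne heq.symm hy hyj v hv
            · obtain rfl := List.mem_singleton.1 hv
              exact fun h => hrow ⟨v, hx, h⟩
          have hl := hll.concat hm heq.symm hy hyj hne
          -- The old tail `x` becomes an inner node, now followed by `y`; this is the only situation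
          -- in which a link field is written.
          have hlink : IsLink A B p x := ⟨_, _, _, us', [y], hl, by simp, by simp⟩
          have hst : IsStored (Function.update s.next p (some x)) (s.head (i + 1) j)
              (s.pretail (i + 1) j) (s.tail (i + 1) j) (us' ++ [p] ++ [x]) :=
            IsStored.update (Or.inr ⟨_, x, rfl, hx, hh, hp, hc⟩) hll hlink
          refine ⟨_, _, .ite_neg _ _ _ _ _ _ hb₁ (.ite_neg _ _ _ _ _ _ hb₂
            (.ite_neg _ _ _ _ _ _ hb₃ (.ite_pos _ _ _ _ _ _ hb₄ (.ite_neg _ _ _ _ _ _ hb₅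
            (.ite_neg _ _ _ _ _ _ ?_ (.seq _ _ _ _ _ _ _ (.setNext _ _ _ p ?_)
            (exec_setEntry (fun _ => rfl) (fun _ _ => rfl) (fun _ _ _ => rfl)))))))), ?_, ?_⟩
          · simpa [Cond.Holds, Exp.eval, hi, hj] using hh0
          · simpa [Exp.eval, hi, hj] using hp'
          · simp [Cond.cost, Exp.cost]
          · simp only [Exp.eval, hi, hj, Nat.add_sub_cancel, hx, hty]
            refine extends_setEntry_link hlink (by omega) hl ?_
            rcases hst with ⟨h, -⟩ | ⟨us, x', hu, -, -, -, hc'⟩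
            · simp at h
            obtain ⟨rfl, h⟩ := List.append_inj' hu rfl
            refine Or.inr ⟨us' ++ [p] ++ [x], y, rfl, rfl, ?_, by simp, ?_⟩
            · rw [hh]; simp
            · refine List.isChain_append.2 ⟨hc', List.isChain_singleton _, ?_⟩
              simp
    · refine ⟨_, _, .ite_neg _ _ _ _ _ _ hb₁ (.ite_neg _ _ _ _ _ _ hb₂ (.ite_neg _ _ _ _ _ _ hb₃
        (.ite_neg _ _ _ _ _ _ ?_
        (exec_setEntry (fun _ => rfl) (fun _ _ => rfl) (fun _ _ _ => rfl))))), ?_, ?_⟩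
      · simp only [Cond.Holds, Exp.eval, hi, hj, Nat.add_sub_cancel, hru, hrl]
        rintro ⟨-, h⟩
        rcases ht : s.tail i (j + 1) with _ | y
        · simp [ht] at h
        · exact hcol ⟨y, ht, by simpa [ht] using h⟩
      · simp [Cond.cost, Exp.cost]
      · simp only [Exp.eval, hi, hj, Nat.add_sub_cancel]
        refine extends_setEntry (by omega)
          (hll.congr (edge_of_eq_of_no_last_col hm heq.symm fun y hy hyj => ?_)) hsl
        -- Columns increase along the upper list, so only its tail can lie in column `j + 1`.
        rcases hsu with ⟨rfl, -⟩ | ⟨us, x, rfl, hx, -⟩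
        · simpa using (hlu.1 y).2 hy
        · have hx' := (hlu.1 x).1 (by simp)
          rcases List.mem_append.1 ((hlu.1 y).2 hy) with h | h
          · have := (List.pairwise_append.1 hlu.2).2.2 y h x (by simp)
            have := hx'.1.2.1
            omega
          · obtain rfl := List.mem_singleton.1 h
            exact hcol ⟨y, hx, hyj⟩
  · refine ⟨_, _, .ite_neg _ _ _ _ _ _ hb₁ (.ite_neg _ _ _ _ _ _ hb₂ (.ite_neg _ _ _ _ _ _ ?_
      (.ite_neg _ _ _ _ _ _ ?_
      (exec_setEntry (fun _ => rfl) (fun _ _ => rfl) (fun _ _ _ => rfl))))), ?_, ?_⟩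
    · simp only [Cond.Holds, Exp.eval, hi, hj, Nat.add_sub_cancel, hru, hrl]
      exact hlt.le.not_gt
    · simp only [Cond.Holds, Exp.eval, hi, hj, Nat.add_sub_cancel, hru, hrl]
      exact fun h => hlt.ne' h.1
    · simp [Cond.cost, Exp.cost]
    · simp only [Exp.eval, hi, hj, Nat.add_sub_cancel]
      exact extends_setEntry (by omega) (hll.congr (edge_of_lt_left hm hlt)) hsl

theorem exec_cellStep {s : State α} {i j : ℕ} (hi : s.num 0 = i) (hj : s.num 1 = j)
    (hprev : ∀ i' j', i' ≤ i → j' ≤ j → (i' = i → j' ≠ j) → s.HoldsAt A B i' j') :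
    ∃ s' t, Exec A B cellStep s s' t ∧ t ≤ 200 ∧ Extends A B i j s s' := by
  by_cases hm : IsMatch A B i j
  · obtain ⟨hi0, hj0⟩ := hm.pos
    have hr := (hprev (i - 1) (j - 1) (by omega) (by omega) (by omega)).1
    refine ⟨_, _, .ite_pos _ _ _ _ _ _ ?_
      (exec_setEntry (fun _ => rfl) (fun _ _ => rfl) (fun _ _ _ => rfl)), ?_, ?_⟩
    · simpa only [Cond.Holds, Exp.eval, hi, hj] using hm
    · simp [Cond.cost, Exp.cost]
    · simp only [Exp.eval, hi, hj]
      exact extends_setEntry (by rw [hr, hm.rank_eq]) (isAdjacencyList_singleton hm)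
        (isStored_singleton _ _ _)
  by_cases h0 : 0 < i ∧ 0 < j
  · obtain ⟨i, rfl⟩ := Nat.exists_eq_add_of_lt h0.1
    obtain ⟨j, rfl⟩ := Nat.exists_eq_add_of_lt h0.2
    simp only [zero_add] at *
    exact exec_cellStep_pos hi hj hm (hprev _ _ (by omega) (by omega) (by omega))
      (hprev _ _ (by omega) (by omega) (by omega))
  · have hr : rank A B i j = 0 := by
      rcases Nat.eq_zero_or_pos i with rfl | h
      · simp
      · obtain rfl : j = 0 := by omega
        simp
    refine ⟨_, _, .ite_neg _ _ _ _ _ _ ?_ (.ite_pos _ _ _ _ _ _ ?_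
      (exec_setEntry (fun _ => rfl) (fun _ _ => rfl) (fun _ _ _ => rfl))), ?_, ?_⟩
    · simpa only [Cond.Holds, Exp.eval, hi, hj] using hm
    · simpa only [Cond.Holds, Exp.eval, hi, hj] using h0
    · simp [Cond.cost, Exp.cost]
    · simp only [Exp.eval, hi, hj]
      exact extends_setEntry hr.symm (isAdjacencyList_nil hr) (isStored_nil _ _)

/-! ### The two nested loops and their running time. -/

theorem exec_row {i : ℕ} (hi : i ≤ A.length) (d : ℕ) : ∀ (j : ℕ) (s : State α),
    j + d = B.length + 1 → s.num 0 = i → s.num 1 = j →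
    (∀ i' j', i' ≤ A.length → j' ≤ B.length → (i' < i ∨ i' = i ∧ j' < j) → s.HoldsAt A B i' j') →
    ∃ s' t, Exec A B (.while (.not (.lt .lenB jReg))
        (.seq cellStep (.setNum 1 (.succ jReg)))) s s' t ∧ t ≤ d * 210 + 10 ∧ s'.num 0 = i ∧
      ∀ i' j', i' ≤ A.length → j' ≤ B.length → i' < i + 1 → s'.HoldsAt A B i' j' := by
  induction d with
  | zero =>
    intro j s hd hsi hsj h
    refine ⟨s, _, .while_done _ _ _ ?_, ?_, hsi, fun i' j' h₁ h₂ h₃ => h i' j' h₁ h₂ (by omega)⟩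
    · change ¬ ¬ B.length < s.num 1; omega
    · simp [Cond.cost, Exp.cost]
  | succ d ih =>
    intro j s hd hsi hsj h
    obtain ⟨s₁, t₁, he₁, ht₁, hn₁, hs₁, hk₁⟩ := exec_cellStep (A := A) (B := B) hsi hsj
      fun i' j' h₁ h₂ h₃ => h i' j' (by omega) (by omega) (by omega)
    obtain ⟨s₂, t₂, he₂, ht₂, hn₂, hs₂⟩ := ih (j + 1)
      { s₁ with num := Function.update s₁.num 1 (j + 1) } (by omega) (by simp [hn₁, hsi])
      (by simp) (fun i' j' h₁ h₂ h₃ => by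
        change s₁.HoldsAt A B i' j'
        by_cases h₄ : i' = i ∧ j' = j
        · rw [h₄.1, h₄.2]; exact hs₁
        · exact hk₁ i' j' (by omega) (h i' j' h₁ h₂ (by omega)))
    refine ⟨s₂, _, .while_step _ _ _ _ _ _ t₂ ?_ (.seq _ _ _ _ _ _ _ he₁ (.setNum _ _ _)) ?_, ?_,
      hn₂, hs₂⟩
    · change ¬ B.length < s.num 1; omega
    · simpa only [Exp.eval, hn₁, hsj] using he₂
    · simp only [Cond.cost, Exp.cost]; omega

theorem exec_rows (d : ℕ) : ∀ (i : ℕ) (s : State α),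
    i + d = A.length + 1 → s.num 0 = i →
    (∀ i' j', i' ≤ A.length → j' ≤ B.length → i' < i → s.HoldsAt A B i' j') →
    ∃ s' t, Exec A B (.while (.not (.lt .lenA iReg))
        (.seq (.setNum 1 (.lit 0)) (.seq (.while (.not (.lt .lenB jReg))
          (.seq cellStep (.setNum 1 (.succ jReg)))) (.setNum 0 (.succ iReg))))) s s' t ∧
      t ≤ d * ((B.length + 1) * 210 + 20) + 10 ∧ s'.HoldsGraph A B := by
  induction d with
  | zero =>
    intro i s hd hsi h
    refine ⟨s, _, .while_done _ _ _ ?_, ?_,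
      State.holdsGraph_iff.2 fun i' j' h₁ h₂ => h i' j' h₁ h₂ (by omega)⟩
    · change ¬ ¬ A.length < s.num 0; omega
    · simp [Cond.cost, Exp.cost]
  | succ d ih =>
    intro i s hd hsi h
    obtain ⟨s₁, t₁, he₁, ht₁, hn₁, hs₁⟩ := exec_row (A := A) (B := B) (i := i) (by omega)
      (B.length + 1) 0 { s with num := Function.update s.num 1 0 } (by omega) (by simp [hsi])
      (by simp) (fun i' j' h₁ h₂ h₃ => h i' j' h₁ h₂ (by omega))
    obtain ⟨s₂, t₂, he₂, ht₂, hs₂⟩ := ih (i + 1)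
      { s₁ with num := Function.update s₁.num 0 (i + 1) } (by omega) (by simp)
      (fun i' j' h₁ h₂ h₃ => hs₁ i' j' h₁ h₂ h₃)
    refine ⟨s₂, _, .while_step _ _ _ _ _ _ t₂ ?_ (.seq _ _ _ _ _ _ _ (.setNum _ _ _)
      (.seq _ _ _ _ _ _ _ he₁ (.setNum _ _ _))) ?_, ?_, hs₂⟩
    · change ¬ A.length < s.num 0; omega
    · simpa only [Exp.eval, hn₁] using he₂
    · simp only [Cond.cost, Exp.cost]
      rw [add_mul]
      omega

theorem exec_rowByRow (s : State α) : ∃ s' t, Exec A B (rowByRow cellStep) s s' t ∧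
    t ≤ 250 * ((A.length + 1) * (B.length + 1)) ∧ s'.HoldsGraph A B := by
  obtain ⟨s₁, t₁, he₁, ht₁, hs₁⟩ := exec_rows (A := A) (B := B) (A.length + 1) 0
    { s with num := Function.update s.num 0 0 } (by omega) (by simp)
    (fun i' j' h₁ h₂ h₃ => absurd h₃ (by omega))
  refine ⟨s₁, _, .seq _ _ _ _ _ _ _ (.setNum _ _ _) he₁, ?_, hs₁⟩
  simp only [Exp.cost]
  -- Per position `210`, per row `20`, and `12` once; together at most `250` per position.
  nlinarith [Nat.zero_le (A.length * B.length)]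

/-! ### Traversing a stored list -/

section Stored

variable {next : Node → Ptr} {h p t : Ptr} {u u' : Node} {l₁ l₂ : List Node}

theorem IsStored.first (hs : IsStored next h p t (u :: l₂)) :
    h = some u ∨ h = none ∧ t = some u := by
  rcases hs with ⟨h, -⟩ | ⟨us, v, he, ht, hh, -⟩
  · cases h
  · rcases us with _ | ⟨x, us⟩
    · obtain ⟨rfl, rfl⟩ : u = v ∧ l₂ = [] := by simpa using he
      exact Or.inr ⟨hh, ht⟩
    · obtain ⟨rfl, rfl⟩ : u = x ∧ l₂ = us ++ [v] := by simpa using he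
      exact Or.inl hh

theorem IsStored.last (hs : IsStored next h p t (l₁ ++ [u])) : t = some u := by
  rcases hs with ⟨h, -⟩ | ⟨us, v, he, ht, -⟩
  · simp at h
  · obtain ⟨-, h⟩ := List.append_inj' he rfl
    rw [ht, (List.singleton_inj.1 h)]

/-- Distinctness of the nodes makes the comparisons with tail and pretail reveal the place of `u` in
the list. -/
theorem IsStored.succ (hs : IsStored next h p t (l₁ ++ u :: u' :: l₂))
    (hn : (l₁ ++ u :: u' :: l₂).Nodup) :
    t ≠ some u ∧ (p = some u ∧ t = some u' ∨ p ≠ some u ∧ next u = some u') := by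
  rcases hs with ⟨h, -⟩ | ⟨us, v, he, rfl, -, hp, hc⟩
  · simp at h
  have hn' : (u :: u' :: l₂).Nodup := hn.of_append_right
  rcases List.eq_nil_or_concat l₂ with rfl | ⟨l₂, x, rfl⟩
  · have he' : (l₁ ++ [u]) ++ [u'] = us ++ [v] := by simpa using he
    obtain ⟨rfl, h⟩ := List.append_inj' he' rfl
    obtain rfl := List.singleton_inj.1 h
    refine ⟨fun h => ?_, Or.inl ⟨by simpa using hp, rfl⟩⟩
    simp at h hn'
    exact hn' h.symm
  · rw [List.concat_eq_append] at *
    have he' : (l₁ ++ u :: u' :: l₂) ++ [x] = us ++ [v] := by simpa using he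
    obtain ⟨rfl, h⟩ := List.append_inj' he' rfl
    obtain rfl := List.singleton_inj.1 h
    refine ⟨fun h => ?_, Or.inr ⟨fun h => ?_, ?_⟩⟩
    · obtain rfl := Option.some_inj.1 h
      simp at hn'
    · rw [hp (by simp)] at h
      have h₁ : (u' :: l₂).getLast? = some u := by simpa [List.getLast?_append] using h
      have h₂ := List.mem_of_getLast? h₁
      refine (List.nodup_cons.1 hn').1 ?_
      rw [← List.cons_append]
      exact List.mem_append_left _ h₂
    · exact List.isChain_iff_forall_rel_of_append_cons_cons.1 hc rfl

end Stored

/-- The memory holds the ranks and the adjacency lists `adj`. -/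
def State.Represents (s : State α) (A B : List α) (adj : ℕ → ℕ → List Node) : Prop :=
  ∀ i j : ℕ, i ≤ A.length → j ≤ B.length → s.rank i j = LCS.rank A B i j ∧
    IsAdjacencyList A B i j (adj i j) ∧
      IsStored s.next (s.head i j) (s.pretail i j) (s.tail i j) (adj i j)

/-- Fixing one choice of lists lets all states of the traversal refer to the same `words`. -/
theorem State.HoldsGraph.exists_represents {s : State α} (h : s.HoldsGraph A B) :
    ∃ adj, s.Represents A B adj := by
  have h' : ∀ i j, ∃ l, i ≤ A.length → j ≤ B.length → s.rank i j = LCS.rank A B i j ∧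
      IsAdjacencyList A B i j l ∧
        IsStored s.next (s.head i j) (s.pretail i j) (s.tail i j) l := fun i j => by
    by_cases hij : i ≤ A.length ∧ j ≤ B.length
    · obtain ⟨hr, l, hl⟩ := h i j hij.1 hij.2
      exact ⟨l, fun _ _ => ⟨hr, hl⟩⟩
    · exact ⟨[], fun h₁ h₂ => absurd ⟨h₁, h₂⟩ hij⟩
  choose adj hadj using h'
  exact ⟨adj, hadj⟩

theorem State.Represents.holdsGraph {s : State α} {adj : ℕ → ℕ → List Node}
    (h : s.Represents A B adj) : s.HoldsGraph A B := fun i j hi hj =>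
  ⟨(h i j hi hj).1, adj i j, (h i j hi hj).2⟩

/-! ### The listing program

`work[r]` is the node of rank `r` on the current path, and `work[k + 1]` lies one step beyond the
queried position of rank `k`. -/

/-- The rank of the queried position. -/
abbrev kReg : Exp .num := .reg 2

/-- The current level. -/
abbrev rReg : Exp .num := .reg 3

/-- `0` while descending, `1` while ascending. -/
abbrev modeReg : Exp .num := .reg 4

/-- The row of the vertex whose adjacency list is traversed at the current level. -/
abbrev boxRow : Exp .num := .pred (.row (.work (.succ rReg)))

/-- The column of the vertex whose adjacency list is traversed at the current level. -/
abbrev boxCol : Exp .num := .pred (.col (.work (.succ rReg)))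

/-- Not all levels have been left. -/
def inRange : Cond := .not (.lt kReg rReg)

def printLoop : Cmd :=
  .while inRange (.seq (.print (.row (.work rReg))) (.setNum 3 (.succ rReg)))

def leafStep : Cmd :=
  .seq (.setNum 3 (.lit 1)) (.seq printLoop (.seq .endString
    (.seq (.setNum 3 (.lit 1)) (.setNum 4 (.lit 1)))))

def downStep : Cmd :=
  .seq (.ite (.ptrEq (.head boxRow boxCol) .null)
      (.setWork rReg (.tail boxRow boxCol)) (.setWork rReg (.head boxRow boxCol)))
    (.setNum 3 (.pred rReg))

/-- The tail is tested first and the pretail second, because the link fields of these two nodes may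
belong to other lists. -/
def upStep : Cmd :=
  .ite (.ptrEq (.tail boxRow boxCol) (.work rReg)) (.setNum 3 (.succ rReg))
    (.seq (.ite (.ptrEq (.pretail boxRow boxCol) (.work rReg))
        (.setWork rReg (.tail boxRow boxCol)) (.setWork rReg (.next (.work rReg))))
      (.seq (.setNum 3 (.pred rReg)) (.setNum 4 (.lit 0))))

def traverseStep : Cmd :=
  .ite (.eq modeReg (.lit 0)) (.ite (.eq rReg (.lit 0)) leafStep downStep) upStep

def traverse : Cmd := .while inRange traverseStep

def listLCS : Cmd :=
  .seq (.setNum 2 (.rank (.reg 0) (.reg 1))) (.seq (.setNum 3 kReg) (.seq (.setNum 4 (.lit 0))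
    (.seq (.setWork (.succ kReg) (.mk (.succ (.reg 0)) (.succ (.reg 1)))) traverse)))

/-- In `t` operations the traversal comes from `s` to `s'`. -/
def Leads (A B : List α) (s s' : State α) (t : ℕ) : Prop :=
  ∀ s'' t', Exec A B traverse s' s'' t' → Exec A B traverse s s'' (t + t')

theorem Leads.trans {s s' s'' : State α} {t t' : ℕ} (h : Leads A B s s' t)
    (h' : Leads A B s' s'' t') : Leads A B s s'' (t + t') := fun x y hx => by
  rw [add_assoc]
  exact h _ _ (h' _ _ hx)

theorem not_lt_of_le_holds {s : State α} {k l : ℕ} (hk : s.num 2 = k) (hl : s.num 3 = l)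
    (h : l ≤ k) : inRange.Holds A B s := by
  change ¬ s.num 2 < s.num 3
  omega

/-- The extra `5` is the loop test of cost `4` and one operation for the loop step. -/
theorem leads_of_exec {s s' : State α} {k l t : ℕ} (hk : s.num 2 = k) (hl : s.num 3 = l)
    (h : l ≤ k) (he : Exec A B traverseStep s s' t) : Leads A B s s' (t + 5) := fun s'' t' h' => by
  have := Exec.while_step _ _ _ _ _ _ _ (not_lt_of_le_holds hk hl h) he h'
  rwa [show inRange.cost = 4 from rfl, show 4 + t + t' + 1 = t + 5 + t' by omega] at this

theorem exists_leads_of_exec {s s' s₁ : State α} {k l t : ℕ} (hk : s.num 2 = k)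
    (hl : s.num 3 = l) (h : l ≤ k) (he : Exec A B traverseStep s s₁ t) (ht : t ≤ 95)
    (hs : s₁ = s') : ∃ t ≤ 100, Leads A B s s' t :=
  ⟨t + 5, by omega, hs ▸ leads_of_exec hk hl h he⟩

/-- The nodes in `work[r]`, `work[r + 1]`, … spell the string. -/
def Spells (A : List α) (work : ℕ → Ptr) : ℕ → List α → Prop
  | _, [] => True
  | r, c :: w => (∃ v, work r = some v ∧ symAt A v.1 = some c) ∧ Spells A work (r + 1) w

theorem Spells.congr {work work' : ℕ → Ptr} {w : List α} : ∀ {r : ℕ}, Spells A work r w →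
    (∀ r' ≥ r, work' r' = work r') → Spells A work' r w := by
  induction w with
  | nil => intros; trivial
  | cons c w ih =>
    rintro r ⟨⟨v, hv, hc⟩, hw⟩ h
    exact ⟨⟨v, (h r le_rfl).trans hv, hc⟩, ih hw fun r' hr' => h r' (by omega)⟩

/-! ### Single moves of the traversal. -/

variable {k : ℕ}

theorem exec_printLoop {w : List α} : ∀ {r : ℕ} {s : State α}, s.Represents A B adj →
    s.num 2 = k → s.num 3 = r → r + w.length = k + 1 → Spells A s.work r w →
    ∃ s' t, Exec A B printLoop s s' t ∧ s'.Represents A B adj ∧ s'.num 2 = k ∧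
      s'.work = s.work ∧ s'.out = s.out ++ w.map some ∧ t ≤ 20 * (w.length + 1) := by
  induction w with
  | nil =>
    intro r s hG hk hr hlen _
    refine ⟨s, _, .while_done _ _ _ ?_, hG, hk, rfl, by simp, by simp [inRange, Cond.cost, Exp.cost]⟩
    change ¬ ¬ s.num 2 < s.num 3
    simp at hlen
    omega
  | cons c w ih =>
    rintro r s hG hk hr hlen ⟨⟨v, hv, hc⟩, hw⟩
    rw [List.length_cons] at hlen
    obtain ⟨s', t, he, hG', hk', hwork, hout, ht⟩ := ih (r := r + 1)
      (s := { s with out := s.out ++ [some c], num := Function.update s.num 3 (r + 1) })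
      hG (by simp [hk]) (by simp) (by omega) hw
    refine ⟨s', _, .while_step _ _ _ _ _ _ t (not_lt_of_le_holds hk hr (by omega))
      (.seq _ _ _ _ _ _ _ (.print _ _ c ?_) (.setNum _ _ _)) ?_, hG', hk', hwork, ?_, ?_⟩
    · simpa [Exp.eval, hr, hv] using hc
    · simp only [printLoop] at he
      simpa only [Exp.eval, hr] using he
    · simp [hout]
    · simp only [inRange, Cond.cost, Exp.cost, List.length_cons]
      omega

theorem leads_leaf {w : List α} {s : State α} (hG : s.Represents A B adj)
    (hk : s.num 2 = k) (hr : s.num 3 = 0) (hm : s.num 4 = 0) (hlen : w.length = k)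
    (hw : Spells A s.work 1 w) :
    ∃ s' t, Leads A B s s' t ∧ s'.Represents A B adj ∧ s'.num 2 = k ∧ s'.num 3 = 1 ∧
      s'.num 4 = 1 ∧ s'.work = s.work ∧ s'.out = s.out ++ tape [w] ∧ t ≤ 100 * (k + 1) := by
  obtain ⟨s', t, he, hG', hk', hwork, hout, ht⟩ := exec_printLoop (r := 1) (k := k)
    (s := { s with num := Function.update s.num 3 1 }) hG (by simp [hk]) (by simp) (by omega) hw
  refine ⟨_, _, leads_of_exec hk hr (Nat.zero_le k) (.ite_pos _ _ _ _ _ _ ?_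
    (.ite_pos _ _ _ _ _ _ ?_ (.seq _ _ _ _ _ _ _ (.setNum _ _ _) (.seq _ _ _ _ _ _ _ he
      (.seq _ _ _ _ _ _ _ (.endString _)
        (.seq _ _ _ _ _ _ _ (.setNum _ _ _) (.setNum _ _ _))))))), hG', ?_, ?_, ?_, hwork, ?_, ?_⟩
  · exact hm
  · exact hr
  · simp [hk']
  · simp [Exp.eval]
  · simp [Exp.eval]
  · simp [hout, tape]
  · simp only [Cond.cost, Exp.cost]
    omega

theorem leads_down {l : ℕ} {s : State α} {u v : Node} {vs : List Node}
    (hk : s.num 2 = k) (hr : s.num 3 = l + 1) (hm : s.num 4 = 0) (hl : l + 1 ≤ k)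
    (hv : s.work (l + 2) = some v)
    (hs : IsStored s.next (s.head (v.1 - 1) (v.2 - 1)) (s.pretail (v.1 - 1) (v.2 - 1))
      (s.tail (v.1 - 1) (v.2 - 1)) (u :: vs)) :
    ∃ t ≤ 100, Leads A B s { s with
      num := Function.update s.num 3 l
      work := Function.update s.work (l + 1) (some u) } t := by
  have h₁ : (Cond.eq modeReg (.lit 0)).Holds A B s := hm
  have h₂ : ¬ (Cond.eq rReg (.lit 0)).Holds A B s := by
    change ¬ s.num 3 = 0
    omega
  rcases hs.first with hh | ⟨hh, ht⟩
  · refine exists_leads_of_exec hk hr hl (.ite_pos _ _ _ _ _ _ h₁ (.ite_neg _ _ _ _ _ _ h₂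
      (.seq _ _ _ _ _ _ _ (.ite_neg _ _ _ _ _ _ ?_ (.setWork _ _ _)) (.setNum _ _ _)))) ?_ ?_
    · simp [Cond.Holds, Exp.eval, hr, hv, hh]
    · simp [Cond.cost, Exp.cost]
    · simp [Exp.eval, hr, hv, hh]
  · refine exists_leads_of_exec hk hr hl (.ite_pos _ _ _ _ _ _ h₁ (.ite_neg _ _ _ _ _ _ h₂
      (.seq _ _ _ _ _ _ _ (.ite_pos _ _ _ _ _ _ ?_ (.setWork _ _ _)) (.setNum _ _ _)))) ?_ ?_
    · simp [Cond.Holds, Exp.eval, hr, hv, hh]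
    · simp [Cond.cost, Exp.cost]
    · simp [Exp.eval, hr, hv, ht]

theorem leads_up {l : ℕ} {s : State α} {u v : Node} {us : List Node}
    (hk : s.num 2 = k) (hr : s.num 3 = l + 1) (hm : s.num 4 = 1) (hl : l + 1 ≤ k)
    (hv : s.work (l + 2) = some v) (hu : s.work (l + 1) = some u)
    (hs : IsStored s.next (s.head (v.1 - 1) (v.2 - 1)) (s.pretail (v.1 - 1) (v.2 - 1))
      (s.tail (v.1 - 1) (v.2 - 1)) (us ++ [u])) :
    ∃ t ≤ 100, Leads A B s { s with num := Function.update s.num 3 (l + 2) } t := by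
  have h₁ : ¬ (Cond.eq modeReg (.lit 0)).Holds A B s := by
    change ¬ s.num 4 = 0
    omega
  have ht := hs.last
  refine exists_leads_of_exec hk hr hl (.ite_neg _ _ _ _ _ _ h₁ (.ite_pos _ _ _ _ _ _ ?_
    (.setNum _ _ _))) ?_ ?_
  · simp [Cond.Holds, Exp.eval, hr, hv, hu, ht]
  · simp [Cond.cost, Exp.cost]
  · simp [Exp.eval, hr]

theorem leads_next {l : ℕ} {s : State α} {u u' v : Node} {us vs : List Node}
    (hk : s.num 2 = k) (hr : s.num 3 = l + 1) (hm : s.num 4 = 1) (hl : l + 1 ≤ k)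
    (hv : s.work (l + 2) = some v) (hu : s.work (l + 1) = some u)
    (hs : IsStored s.next (s.head (v.1 - 1) (v.2 - 1)) (s.pretail (v.1 - 1) (v.2 - 1))
      (s.tail (v.1 - 1) (v.2 - 1)) (us ++ u :: u' :: vs)) (hn : (us ++ u :: u' :: vs).Nodup) :
    ∃ t ≤ 100, Leads A B s { s with
      num := Function.update (Function.update s.num 3 l) 4 0
      work := Function.update s.work (l + 1) (some u') } t := by
  have h₁ : ¬ (Cond.eq modeReg (.lit 0)).Holds A B s := by
    change ¬ s.num 4 = 0
    omega
  obtain ⟨ht, ⟨hp, ht'⟩ | ⟨hp, hx⟩⟩ := hs.succ hn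
  · refine exists_leads_of_exec hk hr hl (.ite_neg _ _ _ _ _ _ h₁ (.ite_neg _ _ _ _ _ _ ?_
      (.seq _ _ _ _ _ _ _ (.ite_pos _ _ _ _ _ _ ?_ (.setWork _ _ _))
        (.seq _ _ _ _ _ _ _ (.setNum _ _ _) (.setNum _ _ _))))) ?_ ?_
    · simpa [Cond.Holds, Exp.eval, hr, hv, hu] using ht
    · simpa [Cond.Holds, Exp.eval, hr, hv, hu] using hp
    · simp [Cond.cost, Exp.cost]
    · simp [Exp.eval, hr, hv, ht']
  · refine exists_leads_of_exec hk hr hl (.ite_neg _ _ _ _ _ _ h₁ (.ite_neg _ _ _ _ _ _ ?_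
      (.seq _ _ _ _ _ _ _ (.ite_neg _ _ _ _ _ _ ?_ (.setWork _ _ _))
        (.seq _ _ _ _ _ _ _ (.setNum _ _ _) (.setNum _ _ _))))) ?_ ?_
    · simpa [Cond.Holds, Exp.eval, hr, hv, hu] using ht
    · simpa [Cond.Holds, Exp.eval, hr, hv, hu] using hp
    · simp [Cond.cost, Exp.cost]
    · simp [Exp.eval, hr, hu, hx]

/-- Started in the descending mode at level `l` below the node `v`, the traversal prints the strings
of all paths from the vertex `[v.1 - 1, v.2 - 1]`, each continued by the string `w` of the higher
levels, and returns to the next higher level in the ascending mode. -/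
def Traverses (A B : List α) (adj : ℕ → ℕ → List Node) (k l : ℕ) : Prop :=
  ∀ (v : Node) (w : List α) (s : State α), v.1 - 1 ≤ A.length → v.2 - 1 ≤ B.length →
    rank A B (v.1 - 1) (v.2 - 1) = l → s.Represents A B adj → s.num 2 = k → s.num 3 = l →
    s.num 4 = 0 → s.work (l + 1) = some v → l + w.length = k → Spells A s.work (l + 1) w →
    ∃ s' t, Leads A B s s' t ∧ s'.Represents A B adj ∧ s'.num 2 = k ∧ s'.num 3 = l + 1 ∧
      s'.num 4 = 1 ∧ (∀ r > l, s'.work r = s.work r) ∧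
      s'.out = s.out ++ tape ((words A adj l (v.1 - 1) (v.2 - 1)).map (· ++ w)) ∧
      t ≤ (words A adj l (v.1 - 1) (v.2 - 1)).length * (100 * (k + 1) + 200 * l)

/-- Induction on the nodes still to the right of `u`. Each node costs its subtree plus one move of
at most `100` operations, to the next sibling or upwards. -/
theorem traverses_siblings {l : ℕ} (ih : Traverses A B adj k l) {v : Node} {w : List α}
    (hvA : v.1 - 1 ≤ A.length) (hvB : v.2 - 1 ≤ B.length)
    (hrk : rank A B (v.1 - 1) (v.2 - 1) = l + 1) (hlen : l + 1 + w.length = k) (vs : List Node) :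
    ∀ (us : List Node) (u : Node) (s : State α),
    adj (v.1 - 1) (v.2 - 1) = us ++ u :: vs → s.Represents A B adj → s.num 2 = k → s.num 3 = l →
    s.num 4 = 0 → s.work (l + 1) = some u → s.work (l + 2) = some v → Spells A s.work (l + 2) w →
    ∃ s' t, Leads A B s s' t ∧ s'.Represents A B adj ∧ s'.num 2 = k ∧ s'.num 3 = l + 2 ∧
      s'.num 4 = 1 ∧ (∀ r > l + 1, s'.work r = s.work r) ∧
      s'.out = s.out ++ tape (((u :: vs).flatMap fun v =>
        (words A adj l (v.1 - 1) (v.2 - 1)).map (· ++ (symAt A v.1).toList)).map (· ++ w)) ∧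
      t ≤ ((u :: vs).flatMap fun v =>
        (words A adj l (v.1 - 1) (v.2 - 1)).map (· ++ (symAt A v.1).toList)).length *
          (100 * (k + 1) + 200 * l + 100) := by
  induction vs with
  | nil =>
    intro us u s hadj hG hk hr hm hu hv hw
    obtain ⟨-, hal, -⟩ := hG _ _ hvA hvB
    have he : Edge A B (v.1 - 1) (v.2 - 1) u := (hal.1 u).1 (by simp [hadj])
    obtain ⟨c, hc, -⟩ := he.1.2.2.1
    have hur := he.1.2.2.1.rank_eq
    have huk := he.1.2.2.2
    have h₁ := he.1.1
    have h₂ := he.1.2.1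
    obtain ⟨s₁, t₁, hL₁, hG₁, hk₁, hr₁, hm₁, hw₁, ho₁, ht₁⟩ := ih u (c :: w) s (by omega)
      (by omega) (by omega) hG hk hr hm hu (by rw [List.length_cons]; omega) ⟨⟨u, hu, hc⟩, hw⟩
    have hst := (hG₁ _ _ hvA hvB).2.2
    rw [hadj] at hst
    obtain ⟨t₂, ht₂, hL₂⟩ := leads_up (A := A) (B := B) hk₁ hr₁ hm₁ (by omega)
      ((hw₁ _ (by omega)).trans hv) ((hw₁ _ (by omega)).trans hu) hst
    -- The subtree of `u` contributes at least one string, which pays for the move that leaves it.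
    have hne := List.length_pos_iff.2 (words_ne_nil (A := A) (B := B)
      (fun i j hi hj => (hG i j hi hj).2.1) (i := u.1 - 1) (j := u.2 - 1) (by omega) (by omega))
    rw [show rank A B (u.1 - 1) (u.2 - 1) = l by omega] at hne
    refine ⟨_, _, hL₁.trans hL₂, hG₁, by simp [hk₁], by simp, by simp [hm₁],
      fun r hr => hw₁ r (by omega), ?_, ?_⟩
    · simp [ho₁, hc, Function.comp_def]
    · simp only [List.flatMap_cons, List.flatMap_nil, List.append_nil, List.length_map]
      nlinarith
  | cons u' vs ihv =>
    intro us u s hadj hG hk hr hm hu hv hw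
    obtain ⟨-, hal, -⟩ := hG _ _ hvA hvB
    have he : Edge A B (v.1 - 1) (v.2 - 1) u := (hal.1 u).1 (by simp [hadj])
    obtain ⟨c, hc, -⟩ := he.1.2.2.1
    have hur := he.1.2.2.1.rank_eq
    have huk := he.1.2.2.2
    have h₁ := he.1.1
    have h₂ := he.1.2.1
    obtain ⟨s₁, t₁, hL₁, hG₁, hk₁, hr₁, hm₁, hw₁, ho₁, ht₁⟩ := ih u (c :: w) s (by omega)
      (by omega) (by omega) hG hk hr hm hu (by rw [List.length_cons]; omega) ⟨⟨u, hu, hc⟩, hw⟩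
    have hst := (hG₁ _ _ hvA hvB).2.2
    have hnd := hal.nodup
    rw [hadj] at hst hnd
    obtain ⟨t₂, ht₂, hL₂⟩ := leads_next (A := A) (B := B) hk₁ hr₁ hm₁ (by omega)
      ((hw₁ _ (by omega)).trans hv) ((hw₁ _ (by omega)).trans hu) hst hnd
    have hne := List.length_pos_iff.2 (words_ne_nil (A := A) (B := B)
      (fun i j hi hj => (hG i j hi hj).2.1) (i := u.1 - 1) (j := u.2 - 1) (by omega) (by omega))
    rw [show rank A B (u.1 - 1) (u.2 - 1) = l by omega] at hne
    have hwork : ∀ r > l + 1, Function.update s₁.work (l + 1) (some u') r = s.work r :=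
      fun r hr => by
        rw [Function.update_of_ne (by omega), hw₁ r (by omega)]
    obtain ⟨s₃, t₃, hL₃, hG₃, hk₃, hr₃, hm₃, hw₃, ho₃, ht₃⟩ := ihv (us ++ [u]) u'
      { s₁ with
        num := Function.update (Function.update s₁.num 3 l) 4 0
        work := Function.update s₁.work (l + 1) (some u') }
      (by simp [hadj]) hG₁ (by simp [hk₁]) (by simp) (by simp) (by simp)
      ((hwork _ (by omega)).trans hv) (hw.congr fun r hr => hwork r (by omega))
    refine ⟨_, _, (hL₁.trans hL₂).trans hL₃, hG₃, hk₃, hr₃, hm₃,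
      fun r hr => (hw₃ r hr).trans (hwork r hr), ?_, ?_⟩
    · rw [ho₃, List.flatMap_cons (x := u), List.map_append, tape_append, ← List.append_assoc]
      simp [ho₁, hc, Function.comp_def]
    · rw [List.flatMap_cons (x := u), List.length_append, List.length_map, add_mul]
      nlinarith

/-- Each level adds at most `200` per string: `100` for the descent, charged to the whole nonempty
list of strings, and `100` for the moves away from its nodes. -/
theorem traverses (l : ℕ) : Traverses A B adj k l := by
  induction l with
  | zero =>
    intro v w s _ _ _ hG hk hr hm _ hlen hw
    obtain ⟨s', t, hL, hG', hk', hr', hm', hw', ho', ht'⟩ :=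
      leads_leaf hG hk hr hm (by omega) hw
    exact ⟨s', t, hL, hG', hk', hr', hm', fun r _ => by rw [hw'], by simpa [words] using ho',
      by simpa [words] using ht'⟩
  | succ l ih =>
    intro v w s hvA hvB hrk hG hk hr hm hv hlen hw
    have hne := words_ne_nil (A := A) (B := B) (fun i j hi hj => (hG i j hi hj).2.1) hvA hvB
    rw [hrk] at hne
    rcases hadj : adj (v.1 - 1) (v.2 - 1) with _ | ⟨u, vs⟩
    · simp [words, hadj] at hne
    have hst := (hG _ _ hvA hvB).2.2
    rw [hadj] at hst
    obtain ⟨t₁, ht₁, hL₁⟩ := leads_down (A := A) (B := B) hk hr hm (by omega) hv hst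
    have hwork : ∀ r > l + 1, Function.update s.work (l + 1) (some u) r = s.work r :=
      fun r hr => Function.update_of_ne (by omega) _ _
    obtain ⟨s₂, t₂, hL₂, hG₂, hk₂, hr₂, hm₂, hw₂, ho₂, ht₂⟩ := traverses_siblings ih hvA hvB hrk
      hlen vs [] u { s with
        num := Function.update s.num 3 l
        work := Function.update s.work (l + 1) (some u) } hadj hG (by simp [hk]) (by simp)
      (by simp [hm]) (by simp) ((hwork _ (by omega)).trans hv)
      (hw.congr fun r hr => hwork r (by omega))
    have hlen' := List.length_pos_iff.2 hne
    refine ⟨_, _, hL₁.trans hL₂, hG₂, hk₂, hr₂, hm₂, fun r hr => (hw₂ r hr).trans (hwork r hr),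
      ?_, ?_⟩
    · rw [ho₂, words, hadj]
    · rw [words, hadj] at hlen' ⊢
      nlinarith

theorem exec_listLCS {s : State α} {i j : ℕ} (hs : s.HoldsGraph A B) (hi : i ≤ A.length)
    (hj : j ≤ B.length) (hsi : s.num 0 = i) (hsj : s.num 1 = j) :
    ∃ (s' : State α) (t : ℕ) (ws : List (List α)),
      Exec A B listLCS s s' t ∧ s'.out = s.out ++ tape ws ∧ ws.Nodup ∧
      (∀ w : List α, w ∈ ws ↔ IsLCS w (A.take i) (B.take j)) ∧
      t ≤ 400 * (tape ws).length ∧ s'.HoldsGraph A B := by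
  obtain ⟨adj, hG⟩ := hs.exists_represents
  have hadj := fun i j hi hj => (hG i j hi hj).2.1
  have hrk := (hG i j hi hj).1
  obtain ⟨k, hk⟩ : ∃ k, rank A B i j = k := ⟨_, rfl⟩
  have hmem := mem_words hadj k i j hi hj hk
  have hpos := List.length_pos_iff.2 (words_ne_nil hadj hi hj)
  rw [hk] at hpos hrk
  obtain ⟨s₁, t₁, hL, hG₁, hk₁, hr₁, -, -, ho₁, ht₁⟩ := traverses (adj := adj) (k := k) k
    -- A fictitious parent node: its predecessor coordinates are the queried position.
    (i + 1, j + 1) []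
    { s with
      num := Function.update (Function.update (Function.update s.num 2 k) 3 k) 4 0
      work := Function.update s.work (k + 1) (some (i + 1, j + 1)) }
    hi hj hk hG (by simp) (by simp) (by simp) (by simp) (by simp) trivial
  have hL' := hL s₁ _ (.while_done _ _ _ (by
    change ¬ ¬ s₁.num 2 < s₁.num 3
    omega))
  refine ⟨s₁, _, words A adj k i j, .seq _ _ _ _ _ _ _ (.setNum _ _ _) (.seq _ _ _ _ _ _ _
    (.setNum _ _ _) (.seq _ _ _ _ _ _ _ (.setNum _ _ _) (.seq _ _ _ _ _ _
      (t₁ + (inRange.cost + 1)) (.setWork _ _ _) ?_))), by simpa using ho₁, nodup_words hadj k i j hi hj, hmem, ?_, hG₁.holdsGraph⟩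
  · simpa [Exp.eval, hsi, hsj, hrk] using hL'
  -- All strings have length `k`, so the tape has `k + 1` cells per string, against a cost of at
  -- most `100 * (k + 1) + 200 * k` per string plus a constant for setting up and stopping.
  · rw [length_tape (k := k) fun w hw => (isLCS_take_iff.1 ((hmem w).1 hw)).2.2.trans hk]
    simp only [inRange, Cond.cost, Exp.cost, Nat.add_sub_cancel] at ht₁ ⊢
    nlinarith

end LCS

theorem mainTheorem2 :
    ∃ (cell list : LCS.Cmd) (C : ℕ),
      cell.IsCellStep ∧
      ∀ (α : Type*) (A B : List α),
        (∀ s : LCS.State α, ∃ (s' : LCS.State α) (t : ℕ),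
          LCS.Exec A B (LCS.rowByRow cell) s s' t ∧
          t ≤ C * ((A.length + 1) * (B.length + 1)) ∧
          s'.HoldsGraph A B) ∧
        (∀ (s : LCS.State α) (i j : ℕ), s.HoldsGraph A B →
          i ≤ A.length → j ≤ B.length → s.num 0 = i → s.num 1 = j →
          ∃ (s' : LCS.State α) (t : ℕ) (ws : List (List α)),
            LCS.Exec A B list s s' t ∧
            s'.out = s.out ++ LCS.tape ws ∧
            ws.Nodup ∧
            (∀ w : List α, w ∈ ws ↔ LCS.IsLCS w (A.take i) (B.take j)) ∧
            t ≤ C * (LCS.tape ws).length ∧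
            s'.HoldsGraph A B) := by
  refine ⟨LCS.cellStep, LCS.listLCS, 400, LCS.isCellStep_cellStep, fun α A B =>
    ⟨fun s => ?_, fun s i j hs hi hj hsi hsj => LCS.exec_listLCS hs hi hj hsi hsj⟩⟩
  obtain ⟨s', t, he, ht, hs⟩ := LCS.exec_rowByRow (A := A) (B := B) s
  exact ⟨s', t, he, ht.trans (Nat.mul_le_mul_right _ (by norm_num)), hs⟩
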